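/- Consider agents indexed by a finite set $\mathcal V$ with states $x_i\in\mathbb R^n$ and dynamics $\dot x_i=Ax_i+Bu_i$, $u_i\in\mathbb R^p$, one of which, agent $1$, is the leader with $u_1=0$; the others are the followers. Let $\mathcal G$ be a directed graph on $\mathcal V$ without self-loops, with $a_{ij}=1$ if $(j,i)$ is an edge and $a_{ij}=0$ otherwise. Assume that $(A,B)$ is stabilizable, that the subgraph of the followers is undirected, and that the leader has a directed path to every other agent (i.e. $\mathcal G$ has a directed spanning tree rooted at the leader). Let $P=P^T>0$ solve $PA+A^TP-PBB^TP+I=0$, and put $K=-B^TP$, $\Gamma=PBB^TP$. Let $\delta,\mu,\nu>0$, and for every edge $(j,i)$ ending at a follower $i$ let $\kappa_{ij},\varrho_{ij}>0$, with $\kappa_{ij}=\kappa_{ji}$ and $\varrho_{ij}=\varrho_{ji}$ when $j$ is a follower too. For an initial time $t_0\ge 0$, put $\tilde x_1(t)=e^{A(t-t_0)}x_1(t_0)$, and for each follower $i$ put $\tilde x_i(t)=e^{A(t-t_k^i)}x_i(t_k^i)$ for $t\in[t_k^i,t_{k+1}^i)$ and $e_i=\tilde x_i-x_i$, where $t_0^i=t_0<t_1^i<t_2^i<\cdots$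 is the finite or infinite sequence of triggering instants of $i$ (if it ends with $t_k^i$, then $t_{k+1}^i=\infty$). Each follower uses the protocol $$u_i=K\sum_{j}c_{ij}a_{ij}(\tilde x_i-\tilde x_j),\qquad \dot c_{ij}=\kappa_{ij}a_{ij}\bigl[-\varrho_{ij}c_{ij}+(\tilde x_i-\tilde x_j)^T\Gamma(\tilde x_i-\tilde x_j)\bigr],$$ where $c_{ij}(t_0)=c_{ji}(t_0)$ for every edge $(j,i)$ between followers, and the triggering function $$f_i(t)=\tfrac12(1+\delta c_{i1})a_{i1}e_i^T\Gamma e_i+\sum_{j\ne1}(1+\delta c_{ij})a_{ij}e_i^T\Gamma e_i-\tfrac14\sum_{j}a_{ij}(\tilde x_i-\tilde x_j)^T\Gamma(\tilde x_i-\tilde x_j)-\mu e^{-\nu t}-\tfrac12a_{i1}(\tilde x_i-\tilde x_1)^T\Gamma(\tilde x_i-\tilde x_1);$$ $t_{k+1}^i$ is the first instant after $t_k^i$ at which $f_i\ge0$, where $\tilde x_i$ is continued from $t_k^i$ without update (and where the estimates of other agents that are updated at the same instant may be taken before or after their update). Solutions on an interval $[t_0,T)$, $T\in(t_0,\infty]$,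 are continuous functions $x_i$, $c_{ij}$ that satisfy the differential equations with right derivatives, such that every $t\in[t_0,T)$ lies, for each follower $i$, in some $[t_k^i,t_{k+1}^i)$. Then: 1. The tracking errors $x_i-x_1$ of the followers $i$ and the coupling gains $c_{ij}$ of the edges $(j,i)$ ending at followers are uniformly ultimately bounded: there is $b>0$ such that for every $a>0$ there is $\theta\ge0$ such that for every $t_0\ge0$ and every solution on $[t_0,T)$, if $\|x_i(t_0)-x_1(t_0)\|\le a$ and $|c_{ij}(t_0)|\le a$ for all these $i$ and $(j,i)$, then $\|x_i(t)-x_1(t)\|\le b$ and $|c_{ij}(t)|\le b$ for all these $i$ and $(j,i)$ and all $t\in[t_0+\theta,T)$. 2. There is no Zeno behavior: for every solution on $[t_0,T)$, each follower has only finitely many triggering instants in every bounded part of $[t_0,T)$; in particular the triggering instants cannot accumulate at a finite $T$. -/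

import Mathlib

open Matrix Filter Topology

/-- `(A, B)` is stabilizable: some state feedback `F` makes `A + B F` Hurwitz, i.e. all complex
eigenvalues of `A + B F` have negative real part. -/
def Stabilizable {n p : ℕ} (A : Matrix (Fin n) (Fin n) ℝ) (B : Matrix (Fin n) (Fin p) ℝ) : Prop :=
  ∃ F : Matrix (Fin p) (Fin n) ℝ,
    ∀ z ∈ spectrum ℂ ((A + B * F).map Complex.ofReal), z.re < 0

/-- Assumptions on a leader-follower communication graph with leader `ℓ`: edges join distinct
nodes, the subgraph of the followers is undirected, and the leader has a directed path to every
node (so that it is the root of a directed spanning tree). -/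
structure IsLeaderFollowerGraph {V : Type*} (G : Digraph V) (ℓ : V) : Prop where
  loopless : ∀ i, ¬ G.Adj i i
  undirected : ∀ i j, i ≠ ℓ → j ≠ ℓ → G.Adj i j → G.Adj j i
  rooted : ∀ i, Relation.ReflTransGen G.Adj ℓ i

open Classical in
/-- Entry `a_ij` of the adjacency matrix: `1` if `(j, i)` is an edge, `0` otherwise. -/
noncomputable def adjEntry {V : Type*} (G : Digraph V) (i j : V) : ℝ :=
  if G.Adj j i then 1 else 0

/-- The quadratic form `vᵀ Γ v`. -/
def quadForm {n : ℕ} (Γ : Matrix (Fin n) (Fin n) ℝ) (v : Fin n → ℝ) : ℝ :=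
  v ⬝ᵥ (Γ *ᵥ v)

/-- The open-loop prediction `e^{A (t - r)} v` at time `t` from the value `v` sampled at time `r`. -/
noncomputable def predict {n : ℕ} (A : Matrix (Fin n) (Fin n) ℝ) (r : ℝ) (v : Fin n → ℝ) (t : ℝ) :
    Fin n → ℝ :=
  NormedSpace.exp ((t - r) • A) *ᵥ v

/-- The data of the event-triggered adaptive protocol: feedback gains `K`, `Γ`, adaptation rates
`κ i j`, leakage constants `ϱ i j`, and the constants `δ`, `μ`, `ν` of the triggering functions. -/
structure Protocol (V : Type*) (n p : ℕ) where
  K : Matrix (Fin p) (Fin n) ℝ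
  Γ : Matrix (Fin n) (Fin n) ℝ
  κ : V → V → ℝ
  ϱ : V → V → ℝ
  δ : ℝ
  μ : ℝ
  ν : ℝ

/-- The constants of the protocol are positive, and symmetric between followers. Only the entries
belonging to edges that end at a follower play a role. -/
structure Protocol.Admissible {V : Type*} {n p : ℕ} (R : Protocol V n p) (G : Digraph V) (ℓ : V) :
    Prop where
  κ_pos : ∀ i j, i ≠ ℓ → G.Adj j i → 0 < R.κ i j
  ϱ_pos : ∀ i j, i ≠ ℓ → G.Adj j i → 0 < R.ϱ i j
  κ_symm : ∀ i j, i ≠ ℓ → j ≠ ℓ → G.Adj j i → R.κ i j = R.κ j i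
  ϱ_symm : ∀ i j, i ≠ ℓ → j ≠ ℓ → G.Adj j i → R.ϱ i j = R.ϱ j i
  δ_pos : 0 < R.δ
  μ_pos : 0 < R.μ
  ν_pos : 0 < R.ν

/-- The control input of follower `i`, from the estimates `y` and the coupling gains `g = c_i·`:
`u_i = K ∑_j c_ij a_ij (y_i - y_j)`. -/
noncomputable def Protocol.input {V : Type*} [Fintype V] {n p : ℕ} (R : Protocol V n p)
    (G : Digraph V) (i : V) (y : V → Fin n → ℝ) (g : V → ℝ) : Fin p → ℝ :=
  R.K *ᵥ ∑ j, (g j * adjEntry G i j) • (y i - y j)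

/-- The triggering function of follower `i` at time `t`, as a function of its own estimate `w`,
the estimates `y j` of the other agents, its true state `ξ` (so that `w - ξ` is the measurement
error) and its coupling gains `g = c_i·`. -/
noncomputable def Protocol.trigger {V : Type*} [Fintype V] [DecidableEq V] {n p : ℕ}
    (R : Protocol V n p) (G : Digraph V) (ℓ i : V) (w : Fin n → ℝ) (y : V → Fin n → ℝ)
    (ξ : Fin n → ℝ) (g : V → ℝ) (t : ℝ) : ℝ :=
  1 / 2 * (1 + R.δ * g ℓ) * adjEntry G i ℓ * quadForm R.Γ (w - ξ)
    + ∑ j ∈ Finset.univ.erase ℓ, (1 + R.δ * g j) * adjEntry G i j * quadForm R.Γ (w - ξ)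
    - 1 / 4 * ∑ j, adjEntry G i j * quadForm R.Γ (w - y j)
    - R.μ * Real.exp (-R.ν * t)
    - 1 / 2 * adjEntry G i ℓ * quadForm R.Γ (w - y ℓ)

/-- A candidate closed-loop evolution: states `x i t`, estimates `xt i t`, coupling gains `c i j t`
and triggering instants `τ i k` (`τ i k = ⊤` means that there is no `k`-th event). -/
structure Evolution (V : Type*) (n : ℕ) where
  x : V → ℝ → Fin n → ℝ
  xt : V → ℝ → Fin n → ℝ
  c : V → V → ℝ → ℝ
  τ : V → ℕ → EReal

/-- `S` is an evolution of the closed loop on the time interval `[t₀, T)`, `T ≤ ∞`.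

The states and gains are continuous and satisfy their differential equations with the one-sided
(right) derivative, because the inputs jump at the triggering instants. Each time of `[t₀, T)` lies
in some `[τ i k, τ i (k+1))`; the instants `τ i k` are allowed to accumulate at `T`, but nothing is
said about the evolution at or after such an accumulation. -/
structure Evolution.IsClosedLoop {V : Type*} [Fintype V] [DecidableEq V] {n p : ℕ}
    (S : Evolution V n) (G : Digraph V) (ℓ : V) (A : Matrix (Fin n) (Fin n) ℝ)
    (B : Matrix (Fin n) (Fin p) ℝ) (R : Protocol V n p) (t₀ : ℝ) (T : EReal) : Prop where
  start_lt : (t₀ : EReal) < T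
  x_cont : ∀ i, ContinuousOn (S.x i) {t | t₀ ≤ t ∧ (t : EReal) < T}
  c_cont : ∀ i j, i ≠ ℓ → ContinuousOn (S.c i j) {t | t₀ ≤ t ∧ (t : EReal) < T}
  /-- The leader has zero input. -/
  leader : ∀ t : ℝ, t₀ ≤ t → (t : EReal) < T →
    HasDerivWithinAt (S.x ℓ) (A *ᵥ S.x ℓ t) (Set.Ici t) t
  follower : ∀ i, i ≠ ℓ → ∀ t : ℝ, t₀ ≤ t → (t : EReal) < T →
    HasDerivWithinAt (S.x i)
      (A *ᵥ S.x i t + B *ᵥ R.input G i (fun j => S.xt j t) (fun j => S.c i j t)) (Set.Ici t) t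
  gain : ∀ i j, i ≠ ℓ → ∀ t : ℝ, t₀ ≤ t → (t : EReal) < T →
    HasDerivWithinAt (S.c i j)
      (R.κ i j * adjEntry G i j *
        (-R.ϱ i j * S.c i j t + quadForm R.Γ (S.xt i t - S.xt j t))) (Set.Ici t) t
  gain_symm : ∀ i j, i ≠ ℓ → j ≠ ℓ → G.Adj j i → S.c i j t₀ = S.c j i t₀
  /-- The estimate of the leader. -/
  xt_leader : ∀ t : ℝ, t₀ ≤ t → (t : EReal) < T → S.xt ℓ t = predict A t₀ (S.x ℓ t₀) t
  /-- The estimate of a follower is predicted from its latest triggering instant. -/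
  xt_follower : ∀ i, i ≠ ℓ → ∀ (k : ℕ) (r t : ℝ), S.τ i k = r → r ≤ t →
    (t : EReal) < S.τ i (k + 1) → (t : EReal) < T → S.xt i t = predict A r (S.x i r) t
  τ_zero : ∀ i, i ≠ ℓ → S.τ i 0 = t₀
  τ_mono : ∀ i, i ≠ ℓ → Monotone (S.τ i)
  τ_lt : ∀ i, i ≠ ℓ → ∀ k, S.τ i k < T → S.τ i k < S.τ i (k + 1)
  τ_cover : ∀ i, i ≠ ℓ → ∀ t : ℝ, t₀ ≤ t → (t : EReal) < T →
    ∃ k, S.τ i k ≤ t ∧ (t : EReal) < S.τ i (k + 1)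
  /-- No triggering instant is missed: the triggering function stays negative from each triggering
  instant up to the next one. -/
  no_miss : ∀ i, i ≠ ℓ → ∀ t : ℝ, t₀ ≤ t → (t : EReal) < T →
    R.trigger G ℓ i (S.xt i t) (fun j => S.xt j t) (S.x i t) (fun j => S.c i j t) t < 0
  /-- An event of `i` at time `s` occurs only if the triggering function, with the estimate of `i`
  not yet updated, has become nonnegative. If other agents broadcast at the same instant, their
  estimates may enter with the value before or after the update; both conventions are admitted. -/
  fires : ∀ i, i ≠ ℓ → ∀ (k : ℕ) (r s : ℝ), S.τ i k = r → S.τ i (k + 1) = s → (s : EReal) < T →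
    ∃ y : V → Fin n → ℝ,
      (∀ j, y j = S.xt j s ∨ Tendsto (S.xt j) (𝓝[<] s) (𝓝 (y j))) ∧
      0 ≤ R.trigger G ℓ i (predict A r (S.x i r) s) y (S.x i s) (fun j => S.c i j s) s

/-- The Euclidean norm of the tracking error `x_i - x_ℓ` at time `t`. -/
noncomputable def Evolution.trackingError {V : Type*} {n : ℕ} (S : Evolution V n) (ℓ i : V)
    (t : ℝ) : ℝ :=
  ‖WithLp.toLp 2 (S.x i t - S.x ℓ t)‖

/-- At time `t` all tracking errors of the followers, and all coupling gains of edges that end at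
a follower, are bounded by `r`. -/
def Evolution.BoundedAt {V : Type*} {n : ℕ} (S : Evolution V n) (G : Digraph V) (ℓ : V) (r t : ℝ) :
    Prop :=
  (∀ i, i ≠ ℓ → S.trackingError ℓ i t ≤ r) ∧
    ∀ i j, i ≠ ℓ → G.Adj j i → |S.c i j t| ≤ r

/-! ### One-sided differential inequalities -/

/-! Write ξ_i = x_i - x_1, let y be the estimates, q the quadratic form of Γ, and D the sum of q(y_i
- y_j) over the edges ending at followers. The Lyapunov function is Σ ξ_iᵀPξ_i + Σ a_ij (c_ij - α)²
/ (4 κ_ij). The Riccati equation turns the drift into Σ (q(ξ_i) - |ξ_i|²). The leader's estimate is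
exact, so ξ_i = (y_i - y_1) - e_i; the follower gains stay symmetric, so the coupling can be summed
by parts, and Young's inequality on the e_i leaves -½ Σ c_ij a_ij q(y_i - y_j) plus terms |c_ij|
q(e_i) and a multiple of D. The adaptation law contributes the same sum with +½, which cancels,
together with -(α/2) D and a leakage term that damps (c_ij - α)² up to a constant. Hence an error
bound β|ξ_i|² + L·D + C is enough: a large α absorbs D (`Protocol.lyapunovDeriv_le`), and Grönwall's
inequality finishes.

The error bound must come from the negative triggering function, which controls only W_i q(e_i) with
a weight W_i affine in the gains. Initial gains may be negative, and then W_i may be too. But the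
drive of the gains is nonnegative, so negative parts decay exponentially, and there are two phases.
For a time depending only on the initial size, a crude bound with β ≥ 0 allows at most exponential
growth (`exists_boundedAt_of_horizon`). Afterwards all gains are at least -1/(2δ), W_i ≥ 1/4
dominates the gains, reachability from the leader bounds q(ξ_i) by D and q(e_i), and β = 0: the
Lyapunov function decays into a ball independent of the initial data
(`exists_ultimate_bound_of_neg_le`). The phases use different α and are joined through bounds on
states and gains.

For Zeno behavior, the crude bound holds on every bounded horizon, uniformly up to T. There e_i
restarts from 0 at each event with bounded velocity, while the next event needs W_i q(e_i) ≥ μ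
e^{-νt}; this forces a positive gap (`Evolution.IsClosedLoop.exists_gap`). -/

theorem le_gronwallBound_of_hasDerivWithinAt_Ici {f f' : ℝ → ℝ} {K C v a b : ℝ}
    (hf : ContinuousOn f (Set.Icc a b))
    (hf' : ∀ t ∈ Set.Ico a b, HasDerivWithinAt f (f' t) (Set.Ici t) t)
    (hv : f a ≤ v) (bound : ∀ t ∈ Set.Ico a b, f' t ≤ K * f t + C) :
    ∀ t ∈ Set.Icc a b, f t ≤ gronwallBound v K C (t - a) :=
  le_gronwallBound_of_liminf_deriv_right_le hf
    (fun t ht _ hr => (hf' t ht).liminf_right_slope_le hr) hv bound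

/-! ### Quadratic forms -/

section QuadForm

variable {n p : ℕ}

theorem dotProduct_mulVec_comm {Γ : Matrix (Fin n) (Fin n) ℝ} (hΓ : Γᵀ = Γ) (u v : Fin n → ℝ) :
    u ⬝ᵥ Γ *ᵥ v = v ⬝ᵥ Γ *ᵥ u := by
  rw [dotProduct_mulVec, ← mulVec_transpose, hΓ, dotProduct_comm]

theorem quadForm_add {Γ : Matrix (Fin n) (Fin n) ℝ} (hΓ : Γᵀ = Γ) (u v : Fin n → ℝ) :
    quadForm Γ (u + v) = quadForm Γ u + 2 * (u ⬝ᵥ Γ *ᵥ v) + quadForm Γ v := by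
  simp only [quadForm, mulVec_add, dotProduct_add, add_dotProduct, dotProduct_mulVec_comm hΓ v u]
  ring

theorem quadForm_neg (Γ : Matrix (Fin n) (Fin n) ℝ) (u : Fin n → ℝ) :
    quadForm Γ (-u) = quadForm Γ u := by
  simp [quadForm, mulVec_neg]

theorem quadForm_sub_comm (Γ : Matrix (Fin n) (Fin n) ℝ) (u v : Fin n → ℝ) :
    quadForm Γ (u - v) = quadForm Γ (v - u) := by
  rw [← quadForm_neg, neg_sub]

theorem quadForm_smul (Γ : Matrix (Fin n) (Fin n) ℝ) (r : ℝ) (u : Fin n → ℝ) :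
    quadForm Γ (r • u) = r ^ 2 * quadForm Γ u := by
  simp only [quadForm, mulVec_smul, dotProduct_smul, smul_dotProduct, smul_eq_mul]
  ring

@[simp] theorem quadForm_zero (Γ : Matrix (Fin n) (Fin n) ℝ) : quadForm Γ 0 = 0 := by
  simp [quadForm]

theorem quadForm_add_le {Γ : Matrix (Fin n) (Fin n) ℝ} (hΓ : Γᵀ = Γ)
    (hq : ∀ v, 0 ≤ quadForm Γ v) (u v : Fin n → ℝ) :
    quadForm Γ (u + v) ≤ 2 * quadForm Γ u + 2 * quadForm Γ v := by
  have h := hq (u + -v)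
  rw [quadForm_add hΓ, quadForm_neg] at h
  rw [quadForm_add hΓ]
  simp only [mulVec_neg, dotProduct_neg] at h
  linarith

/-- Young's inequality with weights `2` and `1 / 2`. -/
theorem mul_dotProduct_mulVec_le {Γ : Matrix (Fin n) (Fin n) ℝ} (hΓ : Γᵀ = Γ)
    (hq : ∀ v, 0 ≤ quadForm Γ v) (c : ℝ) (u v : Fin n → ℝ) :
    2 * (c * (u ⬝ᵥ Γ *ᵥ v)) ≤ |c| * (2 * quadForm Γ u + 1 / 2 * quadForm Γ v) := by
  -- Nonnegativity at 2u + v and at 2u - v bounds the cross term from both sides, which serves both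
  -- signs of c.
  have h1 := hq ((2 : ℝ) • u + v)
  have h2 := hq ((2 : ℝ) • u + -v)
  rw [quadForm_add hΓ, quadForm_smul] at h1 h2
  rw [quadForm_neg] at h2
  simp only [mulVec_neg, dotProduct_neg, smul_dotProduct, smul_eq_mul] at h1 h2
  rcases abs_cases c with ⟨h, hc⟩ | ⟨h, hc⟩ <;> rw [h] <;> nlinarith

theorem sum_sq_eq_dotProduct (v : Fin n → ℝ) : v ⬝ᵥ v = ∑ i, v i ^ 2 := by
  simp [dotProduct, sq]

theorem dotProduct_self_nonneg' (v : Fin n → ℝ) : 0 ≤ v ⬝ᵥ v := by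
  rw [sum_sq_eq_dotProduct]; positivity

/-- A quadratic form is bounded above by a multiple of the squared Euclidean norm. -/
theorem exists_quadForm_le (M : Matrix (Fin n) (Fin n) ℝ) :
    ∃ C : ℝ, 0 < C ∧ ∀ v, quadForm M v ≤ C * (v ⬝ᵥ v) := by
  refine ⟨1 + ∑ i, ∑ j, |M i j|, by positivity, fun v => ?_⟩
  have hsq : ∀ i, v i ^ 2 ≤ v ⬝ᵥ v := fun i => by
    rw [sum_sq_eq_dotProduct]
    exact Finset.single_le_sum (f := fun i => v i ^ 2) (fun _ _ => sq_nonneg _)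
      (Finset.mem_univ i)
  have h : quadForm M v ≤ (∑ i, ∑ j, |M i j|) * (v ⬝ᵥ v) := by
    have h0 : quadForm M v = ∑ i, ∑ j, v i * (M i j * v j) := by
      simp only [quadForm, mulVec, dotProduct, Finset.mul_sum]
    rw [h0, Finset.sum_mul]
    refine Finset.sum_le_sum fun i _ => ?_
    rw [Finset.sum_mul]
    refine Finset.sum_le_sum fun j _ => ?_
    have hi := hsq i
    have hj := hsq j
    have hM := abs_nonneg (M i j)
    calc v i * (M i j * v j) ≤ |v i * (M i j * v j)| := le_abs_self _
      _ = |M i j| * (|v i| * |v j|) := by rw [abs_mul, abs_mul]; ring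
      _ ≤ |M i j| * (v ⬝ᵥ v) := by
        refine mul_le_mul_of_nonneg_left ?_ hM
        nlinarith [sq_nonneg (|v i| - |v j|), sq_abs (v i), sq_abs (v j)]
  linarith [dotProduct_self_nonneg' v]

/-- A positive definite quadratic form is bounded below by a multiple of the squared Euclidean
norm. -/
theorem exists_le_quadForm_of_posDef {P : Matrix (Fin n) (Fin n) ℝ} (hP : P.PosDef) :
    ∃ r : ℝ, 0 < r ∧ ∀ v, r * (v ⬝ᵥ v) ≤ quadForm P v := by
  have hpos : ∀ v : Fin n → ℝ, v ≠ 0 → 0 < quadForm P v := fun v hv => by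
    simpa [quadForm] using hP.dotProduct_mulVec_pos hv
  let s : Set (Fin n → ℝ) := {v | v ⬝ᵥ v = 1}
  have hcont : Continuous fun v : Fin n → ℝ => quadForm P v := by
    unfold quadForm
    fun_prop
  have hs : IsCompact s := by
    refine Metric.isCompact_of_isClosed_isBounded
      (isClosed_eq (by fun_prop) continuous_const) ?_
    refine (Metric.isBounded_closedBall (x := (0 : Fin n → ℝ)) (r := 1)).subset fun v hv => ?_
    rw [mem_closedBall_zero_iff, pi_norm_le_iff_of_nonneg zero_le_one]
    intro i
    have hi : v i ^ 2 ≤ 1 := by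
      have hv' : v ⬝ᵥ v = 1 := hv
      rw [← hv', sum_sq_eq_dotProduct]
      exact Finset.single_le_sum (f := fun i => v i ^ 2) (fun _ _ => sq_nonneg _)
        (Finset.mem_univ i)
    rw [Real.norm_eq_abs]
    exact (sq_le_one_iff_abs_le_one _).mp hi
  obtain ⟨r, hr, hrs⟩ : ∃ r : ℝ, 0 < r ∧ ∀ v ∈ s, r ≤ quadForm P v := by
    rcases s.eq_empty_or_nonempty with he | hne
    -- The unit sphere is empty for n = 0, and any positive constant will do.
    · exact ⟨1, one_pos, by simp [he]⟩
    · obtain ⟨w, hw, hmin⟩ := hs.exists_isMinOn hne hcont.continuousOn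
      refine ⟨quadForm P w, hpos w ?_, fun v hv => hmin hv⟩
      rintro rfl
      simp [s] at hw
  refine ⟨r, hr, fun v => ?_⟩
  rcases eq_or_ne v 0 with rfl | hv
  · simp
  have hvv : 0 < v ⬝ᵥ v :=
    lt_of_le_of_ne (dotProduct_self_nonneg' v) fun h => hv (dotProduct_self_eq_zero.mp h.symm)
  have hsq : 0 < √(v ⬝ᵥ v) := Real.sqrt_pos.mpr hvv
  have h := hrs ((√(v ⬝ᵥ v))⁻¹ • v) (by
    simp only [s, Set.mem_ofPred_eq, smul_dotProduct, dotProduct_smul, smul_eq_mul]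
    rw [← mul_assoc, ← mul_inv, Real.mul_self_sqrt hvv.le, inv_mul_cancel₀ hvv.ne'])
  rw [quadForm_smul, inv_pow, Real.sq_sqrt hvv.le] at h
  have := mul_le_mul_of_nonneg_right h hvv.le
  rwa [mul_right_comm, inv_mul_cancel₀ hvv.ne', one_mul] at this

theorem hasDerivWithinAt_quadForm {P : Matrix (Fin n) (Fin n) ℝ} (hP : Pᵀ = P)
    {f : ℝ → Fin n → ℝ} {f' : Fin n → ℝ} {s : Set ℝ} {t : ℝ} (hf : HasDerivWithinAt f f' s t) :
    HasDerivWithinAt (fun t => quadForm P (f t)) (2 * (f t ⬝ᵥ P *ᵥ f')) s t := by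
  have hc := hasDerivWithinAt_pi.mp hf
  have h : HasDerivWithinAt (fun t => ∑ i, f t i * ∑ j, P i j * f t j)
      (∑ i, (f' i * (∑ j, P i j * f t j) + f t i * ∑ j, P i j * f' j)) s t :=
    HasDerivWithinAt.fun_sum fun i _ => (hc i).mul
      (HasDerivWithinAt.fun_sum fun j _ => (hc j).const_mul (P i j))
  refine h.congr_deriv ?_
  rw [Finset.sum_add_distrib]
  change f' ⬝ᵥ P *ᵥ f t + f t ⬝ᵥ P *ᵥ f' = _
  rw [dotProduct_mulVec_comm hP]
  ring

end QuadForm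

/-! ### Open-loop predictions -/

section Predict

variable {n : ℕ}

-- The entrywise form confines the choice of a matrix norm, needed to differentiate the exponential,
-- to this proof.
open scoped Matrix.Norms.Operator in
theorem hasDerivAt_matrix_exp_apply (A : Matrix (Fin n) (Fin n) ℝ) (r t : ℝ) (i j : Fin n) :
    HasDerivAt (fun t : ℝ => NormedSpace.exp ((t - r) • A) i j)
      ((A * NormedSpace.exp ((t - r) • A)) i j) t := by
  have h := (hasDerivAt_exp_smul_const' (𝕂 := ℝ) A (t - r)).scomp t ((hasDerivAt_id t).sub_const r)
  have h2 := (LinearMap.toContinuousLinearMap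
    (Matrix.entryLinearMap ℝ ℝ i j)).hasFDerivAt.comp_hasDerivAt t h
  rw [one_smul] at h2
  exact h2

theorem continuous_matrix_exp (A : Matrix (Fin n) (Fin n) ℝ) :
    Continuous fun t : ℝ => NormedSpace.exp (t • A) := by
  refine continuous_pi fun i => continuous_pi fun j => continuous_iff_continuousAt.mpr fun t => ?_
  simpa using (hasDerivAt_matrix_exp_apply A 0 t i j).continuousAt

theorem hasDerivAt_predict (A : Matrix (Fin n) (Fin n) ℝ) (r : ℝ) (v : Fin n → ℝ) (t : ℝ) :
    HasDerivAt (predict A r v) (A *ᵥ predict A r v t) t := by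
  rw [hasDerivAt_pi]
  intro i
  have h2 := HasDerivAt.fun_sum (u := Finset.univ) fun j _ =>
    (hasDerivAt_matrix_exp_apply A r t i j).mul_const (v j)
  simp only [predict, mulVec_mulVec]
  exact h2

@[simp] theorem predict_self (A : Matrix (Fin n) (Fin n) ℝ) (r : ℝ) (v : Fin n → ℝ) :
    predict A r v r = v := by
  simp [predict]

/-- Over a bounded horizon, predictions of bounded samples are uniformly bounded. -/
theorem exists_norm_predict_le (A : Matrix (Fin n) (Fin n) ℝ) (h X : ℝ) :
    ∃ Y : ℝ, ∀ r t : ℝ, r ≤ t → t ≤ r + h → ∀ v : Fin n → ℝ, ‖v‖ ≤ X → ‖predict A r v t‖ ≤ Y := by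
  have hc : Continuous fun z : ℝ × (Fin n → ℝ) => NormedSpace.exp (z.1 • A) *ᵥ z.2 :=
    ((continuous_matrix_exp A).comp continuous_fst).matrix_mulVec continuous_snd
  obtain ⟨Y, hY⟩ := ((isCompact_Icc (a := (0 : ℝ)) (b := h)).prod
    (isCompact_closedBall (0 : Fin n → ℝ) X)).exists_bound_of_continuousOn hc.continuousOn
  refine ⟨Y, fun r t h1 h2 v hv => hY (t - r, v) ⟨⟨by simp; linarith, by simp; linarith⟩, ?_⟩⟩
  simpa using hv

end Predict

/-! ### Disagreement along the edges of a leader-follower graph -/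

section AdjEntry

variable {V : Type*} {G : Digraph V} {ℓ : V}

theorem adjEntry_of_adj {i j : V} (h : G.Adj j i) : adjEntry G i j = 1 := if_pos h

theorem adjEntry_nonneg (G : Digraph V) (i j : V) : 0 ≤ adjEntry G i j := by
  unfold adjEntry; split <;> simp

theorem adjEntry_comm (hG : IsLeaderFollowerGraph G ℓ) {i j : V} (hi : i ≠ ℓ) (hj : j ≠ ℓ) :
    adjEntry G i j = adjEntry G j i := by
  unfold adjEntry
  by_cases h : G.Adj j i
  · rw [if_pos h, if_pos (hG.undirected _ _ hj hi h)]
  · rw [if_neg h, if_neg fun h' => h (hG.undirected _ _ hi hj h')]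

end AdjEntry

section NodeDisagreement

variable {V : Type*} [Fintype V] {n : ℕ} {G : Digraph V}
  {Γ : Matrix (Fin n) (Fin n) ℝ}

/-- `∑_j a_ij (y_i - y_j)ᵀ Γ (y_i - y_j)`. -/
noncomputable def nodeDisagreement (G : Digraph V) (Γ : Matrix (Fin n) (Fin n) ℝ)
    (Y : V → Fin n → ℝ) (i : V) : ℝ :=
  ∑ j, adjEntry G i j * quadForm Γ (Y i - Y j)

theorem adjEntry_mul_le_nodeDisagreement (hq : ∀ v, 0 ≤ quadForm Γ v) (Y : V → Fin n → ℝ)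
    (i j : V) : adjEntry G i j * quadForm Γ (Y i - Y j) ≤ nodeDisagreement G Γ Y i :=
  Finset.single_le_sum (f := fun j => adjEntry G i j * quadForm Γ (Y i - Y j))
    (fun _ _ => mul_nonneg (adjEntry_nonneg _ _ _) (hq _)) (Finset.mem_univ j)

theorem nodeDisagreement_nonneg (hq : ∀ v, 0 ≤ quadForm Γ v) (Y : V → Fin n → ℝ) (i : V) :
    0 ≤ nodeDisagreement G Γ Y i :=
  Finset.sum_nonneg fun _ _ => mul_nonneg (adjEntry_nonneg _ _ _) (hq _)

/-- The sum of the absolute values of the coupling gains of the edges ending at `i`. -/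
noncomputable def totalGain (G : Digraph V) (g : V → ℝ) (i : V) : ℝ :=
  ∑ j, adjEntry G i j * |g j|

end NodeDisagreement

section Graph

variable {V : Type*} [Fintype V] [DecidableEq V] {n : ℕ} {G : Digraph V} {ℓ : V}
  {Γ : Matrix (Fin n) (Fin n) ℝ}

/-- The total disagreement over the edges that end at a follower. -/
noncomputable def disagreement (G : Digraph V) (ℓ : V) (Γ : Matrix (Fin n) (Fin n) ℝ)
    (Y : V → Fin n → ℝ) : ℝ :=
  ∑ i ∈ Finset.univ.erase ℓ, nodeDisagreement G Γ Y i

theorem nodeDisagreement_le (hq : ∀ v, 0 ≤ quadForm Γ v) (Y : V → Fin n → ℝ) {i : V}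
    (hi : i ≠ ℓ) : nodeDisagreement G Γ Y i ≤ disagreement G ℓ Γ Y :=
  Finset.single_le_sum (f := nodeDisagreement G Γ Y) (fun _ _ => nodeDisagreement_nonneg hq _ _)
    (Finset.mem_erase.mpr ⟨hi, Finset.mem_univ i⟩)

theorem disagreement_nonneg (hq : ∀ v, 0 ≤ quadForm Γ v) (Y : V → Fin n → ℝ) :
    0 ≤ disagreement G ℓ Γ Y :=
  Finset.sum_nonneg fun _ _ => nodeDisagreement_nonneg hq _ _

/-- If all agents are reachable from the leader, the disagreement over edges controls the deviation
of every agent from the leader. -/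
theorem exists_quadForm_sub_le_disagreement (hG : IsLeaderFollowerGraph G ℓ) (hΓ : Γᵀ = Γ)
    (hq : ∀ v, 0 ≤ quadForm Γ v) :
    ∃ C : ℝ, 0 ≤ C ∧ ∀ (Y : V → Fin n → ℝ) (i : V),
      quadForm Γ (Y i - Y ℓ) ≤ C * disagreement G ℓ Γ Y := by
  have key : ∀ i, ∃ C : ℝ, 0 ≤ C ∧ ∀ Y : V → Fin n → ℝ,
      quadForm Γ (Y i - Y ℓ) ≤ C * disagreement G ℓ Γ Y := by
    intro i
    -- Induction along a path from the leader; each further edge costs one use of `quadForm_add_le`.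
    induction hG.rooted i with
    | refl => exact ⟨0, le_rfl, fun Y => by simp⟩
    | @tail b c _ hbc ih =>
      obtain ⟨C, hC, hCY⟩ := ih
      refine ⟨2 + 2 * C, by positivity, fun Y => ?_⟩
      -- The path may return to the leader through an edge that the disagreement does not count; the
      -- deviation is then zero.
      rcases eq_or_ne c ℓ with rfl | hc
      · simpa using mul_nonneg (by positivity : 0 ≤ 2 + 2 * C) (disagreement_nonneg hq Y)
      have h1 := quadForm_add_le hΓ hq (Y c - Y b) (Y b - Y ℓ)
      rw [sub_add_sub_cancel] at h1
      have h2 := adjEntry_mul_le_nodeDisagreement (G := G) hq Y c b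
      rw [adjEntry_of_adj hbc, one_mul] at h2
      have h3 := nodeDisagreement_le (G := G) hq Y hc
      linarith [hCY Y]
  choose C hC hCY using key
  refine ⟨∑ i, C i, Finset.sum_nonneg fun i _ => hC i, fun Y i => (hCY i Y).trans ?_⟩
  exact mul_le_mul_of_nonneg_right
    (Finset.single_le_sum (fun i _ => hC i) (Finset.mem_univ i)) (disagreement_nonneg hq Y)

/-- Summation by parts for couplings that are symmetric between the followers. -/
theorem sum_coupling_eq (Y : V → Fin n → ℝ) (h : V → V → ℝ)
    (hh : ∀ i j, i ≠ ℓ → j ≠ ℓ → h i j = h j i) :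
    2 * ∑ i ∈ Finset.univ.erase ℓ, (Y i - Y ℓ) ⬝ᵥ Γ *ᵥ ∑ j, h i j • (Y i - Y j) =
      ∑ i ∈ Finset.univ.erase ℓ, ∑ j,
        (if j = ℓ then 2 else 1) * (h i j * quadForm Γ (Y i - Y j)) := by
  have hexp : ∀ i, (Y i - Y ℓ) ⬝ᵥ Γ *ᵥ ∑ j, h i j • (Y i - Y j) =
      h i ℓ * quadForm Γ (Y i - Y ℓ) +
        ∑ j ∈ Finset.univ.erase ℓ, h i j * ((Y i - Y ℓ) ⬝ᵥ Γ *ᵥ (Y i - Y j)) := fun i => by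
    rw [mulVec_sum, dotProduct_sum, ← Finset.add_sum_erase _ _ (Finset.mem_univ ℓ)]
    simp [mulVec_smul, dotProduct_smul, quadForm]
  have hrhs : ∀ i, ∑ j, (if j = ℓ then 2 else 1) * (h i j * quadForm Γ (Y i - Y j)) =
      2 * (h i ℓ * quadForm Γ (Y i - Y ℓ)) +
        ∑ j ∈ Finset.univ.erase ℓ, h i j * quadForm Γ (Y i - Y j) := fun i => by
    rw [← Finset.add_sum_erase _ _ (Finset.mem_univ ℓ), if_pos rfl]
    congr 1
    refine Finset.sum_congr rfl fun j hj => ?_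
    rw [if_neg (Finset.ne_of_mem_erase hj), one_mul]
  simp only [hexp, hrhs, Finset.sum_add_distrib, mul_add, ← Finset.mul_sum]
  congr 1
  -- Of the two copies of the sum over pairs of followers, one has its indices exchanged; by
  -- symmetry of h the terms (i, j) of both copies combine to q(Y i - Y j), and Y ℓ cancels.
  rw [two_mul]
  nth_rewrite 2 [Finset.sum_comm]
  rw [← Finset.sum_add_distrib]
  refine Finset.sum_congr rfl fun i hi => ?_
  rw [← Finset.sum_add_distrib]
  refine Finset.sum_congr rfl fun j hj => ?_
  rw [hh j i (Finset.ne_of_mem_erase hj) (Finset.ne_of_mem_erase hi), ← mul_add]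
  congr 1
  have e1 : Y j - Y i = -(Y i - Y j) := by abel
  rw [e1, mulVec_neg, dotProduct_neg, ← sub_eq_add_neg, ← sub_dotProduct, sub_sub_sub_cancel_right]
  rfl

/-- With X i - X ℓ = (Y i - Y ℓ) - (Y i - X i), the first part is summed by parts and the second is
estimated by Young's inequality, which consumes half of the good term. The coefficient 1/2 that
survives is the one cancelled by the adaptation law. -/
theorem neg_sum_coupling_le (hG : IsLeaderFollowerGraph G ℓ) (hΓ : Γᵀ = Γ)
    (hq : ∀ v, 0 ≤ quadForm Γ v) {X Y : V → Fin n → ℝ} {g : V → V → ℝ} {m : ℝ} (hm : 0 ≤ m)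
    (hY : Y ℓ = X ℓ) (hg : ∀ i j, i ≠ ℓ → G.Adj j i → -m ≤ g i j)
    (hsymm : ∀ i j, i ≠ ℓ → j ≠ ℓ → G.Adj j i → g i j = g j i) :
    -(2 * ∑ i ∈ Finset.univ.erase ℓ,
        (X i - X ℓ) ⬝ᵥ Γ *ᵥ ∑ j, (g i j * adjEntry G i j) • (Y i - Y j)) ≤
      -(1 / 2 * ∑ i ∈ Finset.univ.erase ℓ, ∑ j,
          g i j * adjEntry G i j * quadForm Γ (Y i - Y j)) + 2 * m * disagreement G ℓ Γ Y +
        2 * ∑ i ∈ Finset.univ.erase ℓ, totalGain G (g i) i * quadForm Γ (Y i - X i) := by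
  have hh : ∀ i j, i ≠ ℓ → j ≠ ℓ → g i j * adjEntry G i j = g j i * adjEntry G j i := by
    intro i j hi hj
    rw [adjEntry_comm hG hj hi]
    by_cases h : G.Adj j i
    · rw [hsymm i j hi hj h]
    · simp [adjEntry, h]
  have hsplit : ∀ i, (X i - X ℓ) ⬝ᵥ Γ *ᵥ ∑ j, (g i j * adjEntry G i j) • (Y i - Y j) =
      (Y i - Y ℓ) ⬝ᵥ Γ *ᵥ ∑ j, (g i j * adjEntry G i j) • (Y i - Y j) -
        ∑ j, g i j * adjEntry G i j * ((Y i - X i) ⬝ᵥ Γ *ᵥ (Y i - Y j)) := fun i => by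
    have e : X i - X ℓ = (Y i - Y ℓ) - (Y i - X i) := by rw [hY]; abel
    rw [e, sub_dotProduct]
    congr 1
    rw [mulVec_sum, dotProduct_sum]
    simp [mulVec_smul, dotProduct_smul]
  simp only [hsplit, Finset.sum_sub_distrib, mul_sub]
  rw [sum_coupling_eq Y _ hh]
  simp only [disagreement, nodeDisagreement, totalGain, Finset.mul_sum, Finset.sum_mul,
    ← Finset.sum_neg_distrib, neg_sub, ← Finset.sum_sub_distrib, ← Finset.sum_add_distrib]
  refine Finset.sum_le_sum fun i hi => Finset.sum_le_sum fun j _ => ?_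
  by_cases h : G.Adj j i
  · rw [adjEntry_of_adj h]
    have h1 := mul_dotProduct_mulVec_le hΓ hq (g i j) (Y i - X i) (Y i - Y j)
    have h2 := hg i j (Finset.ne_of_mem_erase hi) h
    have h3 := hq (Y i - Y j)
    have h4 := hq (Y i - X i)
    -- For an edge between followers Young's inequality costs m times the form; an edge from the
    -- leader leaves an extra -g ≤ m, whence 2m in the statement.
    have h5 : |g i j| ≤ g i j + 2 * m := abs_le.mpr ⟨by linarith, by linarith⟩
    have h6 := mul_le_mul_of_nonneg_right h5 h3
    have h7 := mul_le_mul_of_nonneg_right h2 h3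
    split <;> nlinarith
  · simp [adjEntry, h]

end Graph

/-! ### The Lyapunov function and the algebra of its derivative -/

section Riccati

variable {V : Type*} {n p : ℕ} {A : Matrix (Fin n) (Fin n) ℝ} {B : Matrix (Fin n) (Fin p) ℝ}
  {P : Matrix (Fin n) (Fin n) ℝ} {R : Protocol V n p}

theorem Protocol.transpose_Γ (hP : Pᵀ = P) (hΓ : R.Γ = P * B * Bᵀ * P) : R.Γᵀ = R.Γ := by
  rw [hΓ]
  simp only [transpose_mul, transpose_transpose, hP, Matrix.mul_assoc]

/-- The form is the squared Euclidean norm of Bᵀ P v. -/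
theorem Protocol.quadForm_Γ_nonneg (hP : Pᵀ = P) (hΓ : R.Γ = P * B * Bᵀ * P) (v : Fin n → ℝ) :
    0 ≤ quadForm R.Γ v := by
  have h : quadForm R.Γ v = (Bᵀ *ᵥ P *ᵥ v) ⬝ᵥ (Bᵀ *ᵥ P *ᵥ v) := by
    have e : v ⬝ᵥ R.Γ *ᵥ v = v ⬝ᵥ P *ᵥ B *ᵥ Bᵀ *ᵥ P *ᵥ v := by
      rw [hΓ]; simp only [mulVec_mulVec, Matrix.mul_assoc]
    rw [quadForm, e, dotProduct_mulVec, ← mulVec_transpose, hP, dotProduct_mulVec,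
      ← mulVec_transpose]
  rw [h, sum_sq_eq_dotProduct]
  positivity

/-- The Riccati equation as an identity of quadratic forms. -/
theorem two_mul_dotProduct_riccati (hP : Pᵀ = P)
    (hARE : P * A + Aᵀ * P - P * B * Bᵀ * P + 1 = 0) (v : Fin n → ℝ) :
    2 * (v ⬝ᵥ P *ᵥ A *ᵥ v) = quadForm (P * B * Bᵀ * P) v - v ⬝ᵥ v := by
  have h1 : v ⬝ᵥ Aᵀ *ᵥ P *ᵥ v = v ⬝ᵥ P *ᵥ A *ᵥ v := by
    rw [mulVec_transpose, dotProduct_comm, ← dotProduct_mulVec, dotProduct_comm,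
      dotProduct_mulVec_comm hP]
  have h2 := congrArg (fun M : Matrix (Fin n) (Fin n) ℝ => v ⬝ᵥ M *ᵥ v) hARE
  simp only [add_mulVec, sub_mulVec, dotProduct_add, dotProduct_sub, one_mulVec, zero_mulVec,
    dotProduct_zero, ← mulVec_mulVec (M := P) (N := A), ← mulVec_mulVec (M := Aᵀ), h1] at h2
  rw [quadForm]
  linarith

end Riccati

section Lyapunov

variable {V : Type*} [Fintype V] [DecidableEq V] {n p : ℕ}

/-- The Lyapunov function `∑_i ξ_iᵀ P ξ_i + ∑_ij a_ij (c_ij - α)² / (4 κ_ij)` of the states and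
gains. -/
noncomputable def Protocol.lyapunov (R : Protocol V n p) (G : Digraph V) (ℓ : V)
    (P : Matrix (Fin n) (Fin n) ℝ) (α : ℝ) (X : V → Fin n → ℝ) (g : V → V → ℝ) : ℝ :=
  ∑ i ∈ Finset.univ.erase ℓ, (quadForm P (X i - X ℓ) +
    ∑ j, adjEntry G i j / (4 * R.κ i j) * (g i j - α) ^ 2)

/-- The derivative of `Protocol.lyapunov` along the closed loop with estimates `Y`. -/
noncomputable def Protocol.lyapunovDeriv (R : Protocol V n p) (G : Digraph V) (ℓ : V)
    (A : Matrix (Fin n) (Fin n) ℝ) (B : Matrix (Fin n) (Fin p) ℝ)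
    (P : Matrix (Fin n) (Fin n) ℝ) (α : ℝ) (X Y : V → Fin n → ℝ) (g : V → V → ℝ) : ℝ :=
  ∑ i ∈ Finset.univ.erase ℓ,
    (2 * ((X i - X ℓ) ⬝ᵥ P *ᵥ (A *ᵥ X i + B *ᵥ R.input G i Y (g i) - A *ᵥ X ℓ)) +
      ∑ j, adjEntry G i j / (4 * R.κ i j) * (2 * (g i j - α) * (R.κ i j * adjEntry G i j *
        (-R.ϱ i j * g i j + quadForm R.Γ (Y i - Y j)))))

variable {G : Digraph V} {ℓ : V} {A : Matrix (Fin n) (Fin n) ℝ} {B : Matrix (Fin n) (Fin p) ℝ}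
  {P : Matrix (Fin n) (Fin n) ℝ} {R : Protocol V n p}

/-- A lower bound for the gains together with a bound for the contribution of the measurement
errors yields a linear differential inequality for the Lyapunov function. -/
theorem Protocol.lyapunovDeriv_le (hG : IsLeaderFollowerGraph G ℓ) (hP : Pᵀ = P)
    (hARE : P * A + Aᵀ * P - P * B * Bᵀ * P + 1 = 0) (hR : R.Admissible G ℓ)
    (hK : R.K = -(Bᵀ * P)) (hΓ : R.Γ = P * B * Bᵀ * P) {m β L C K α : ℝ} (hm : 0 ≤ m)
    (hβ : ∀ v : Fin n → ℝ, (β - 1) * (v ⬝ᵥ v) ≤ K * quadForm P v)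
    (hϱ : ∀ i j, i ≠ ℓ → G.Adj j i → -(R.ϱ i j * R.κ i j) ≤ K)
    (hα : 2 * (2 * m + Fintype.card V * L) ≤ α) (hL : 0 ≤ L) (hC : 0 ≤ C)
    {X Y : V → Fin n → ℝ} {g : V → V → ℝ} (hY : Y ℓ = X ℓ)
    (hg : ∀ i j, i ≠ ℓ → G.Adj j i → -m ≤ g i j)
    (hsymm : ∀ i j, i ≠ ℓ → j ≠ ℓ → G.Adj j i → g i j = g j i)
    (herr : ∀ i, i ≠ ℓ → 2 * (totalGain G (g i) i * quadForm R.Γ (Y i - X i)) +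
      quadForm R.Γ (X i - X ℓ) ≤
        β * ((X i - X ℓ) ⬝ᵥ (X i - X ℓ)) + L * disagreement G ℓ R.Γ Y + C) :
    R.lyapunovDeriv G ℓ A B P α X Y g ≤ K * R.lyapunov G ℓ P α X g +
      (Fintype.card V * C +
        ∑ i ∈ Finset.univ.erase ℓ, ∑ j, 1 / 4 * (adjEntry G i j * R.ϱ i j * α ^ 2)) := by
  have hq := R.quadForm_Γ_nonneg hP hΓ
  have hD := disagreement_nonneg (G := G) (ℓ := ℓ) hq Y
  have hcross := neg_sum_coupling_le hG (R.transpose_Γ hP hΓ) hq hm hY hg hsymm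
  have hstate : ∀ i, 2 * ((X i - X ℓ) ⬝ᵥ P *ᵥ (A *ᵥ X i + B *ᵥ R.input G i Y (g i) - A *ᵥ X ℓ)) =
      (quadForm R.Γ (X i - X ℓ) - (X i - X ℓ) ⬝ᵥ (X i - X ℓ)) -
        2 * ((X i - X ℓ) ⬝ᵥ R.Γ *ᵥ ∑ j, (g i j * adjEntry G i j) • (Y i - Y j)) := fun i => by
    have e : A *ᵥ X i + B *ᵥ R.input G i Y (g i) - A *ᵥ X ℓ =
        A *ᵥ (X i - X ℓ) + B *ᵥ R.input G i Y (g i) := by rw [mulVec_sub]; abel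
    rw [e, mulVec_add, dotProduct_add, mul_add, two_mul_dotProduct_riccati hP hARE, ← hΓ,
      sub_eq_add_neg _ (2 * _)]
    congr 1
    rw [Protocol.input, hK, hΓ, neg_mulVec, mulVec_neg, mulVec_neg, dotProduct_neg, mul_neg]
    simp only [mulVec_mulVec, Matrix.mul_assoc]
  -- The leakage part rests on g(g - α) = ½((g - α)² + g² - α²): the first square is damping, the
  -- second is dropped, the third gives the constant.
  have hgain : ∀ i ∈ Finset.univ.erase ℓ, ∀ j,
      adjEntry G i j / (4 * R.κ i j) * (2 * (g i j - α) * (R.κ i j * adjEntry G i j *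
        (-R.ϱ i j * g i j + quadForm R.Γ (Y i - Y j)))) ≤
      1 / 2 * (g i j * adjEntry G i j * quadForm R.Γ (Y i - Y j)) -
        α / 2 * (adjEntry G i j * quadForm R.Γ (Y i - Y j)) +
        K * (adjEntry G i j / (4 * R.κ i j) * (g i j - α) ^ 2) +
        1 / 4 * (adjEntry G i j * R.ϱ i j * α ^ 2) := by
    intro i hi j
    by_cases h : G.Adj j i
    · have hκ := hR.κ_pos i j (Finset.ne_of_mem_erase hi) h
      have hϱ' := hR.ϱ_pos i j (Finset.ne_of_mem_erase hi) h
      rw [adjEntry_of_adj h]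
      have e1 : 1 / (4 * R.κ i j) * (2 * (g i j - α) * (R.κ i j * 1 *
          (-R.ϱ i j * g i j + quadForm R.Γ (Y i - Y j)))) =
          1 / 2 * (g i j - α) * (-R.ϱ i j * g i j + quadForm R.Γ (Y i - Y j)) := by
        field_simp
        ring
      have e2 : -(R.ϱ i j * (g i j - α) ^ 2 / 4) ≤ K * (1 / (4 * R.κ i j) * (g i j - α) ^ 2) := by
        have := mul_le_mul_of_nonneg_right (hϱ i j (Finset.ne_of_mem_erase hi) h)
          (by positivity : 0 ≤ 1 / (4 * R.κ i j) * (g i j - α) ^ 2)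
        refine le_trans (le_of_eq ?_) this
        field_simp
      rw [e1]
      nlinarith [mul_nonneg hϱ'.le (sq_nonneg (g i j))]
    · simp [adjEntry, h]
  have hsum : R.lyapunovDeriv G ℓ A B P α X Y g ≤
      ∑ i ∈ Finset.univ.erase ℓ, (quadForm R.Γ (X i - X ℓ) - (X i - X ℓ) ⬝ᵥ (X i - X ℓ)) -
        2 * ∑ i ∈ Finset.univ.erase ℓ,
          (X i - X ℓ) ⬝ᵥ R.Γ *ᵥ ∑ j, (g i j * adjEntry G i j) • (Y i - Y j) +
        (1 / 2 * ∑ i ∈ Finset.univ.erase ℓ, ∑ j,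
            g i j * adjEntry G i j * quadForm R.Γ (Y i - Y j) -
          α / 2 * disagreement G ℓ R.Γ Y +
          K * ∑ i ∈ Finset.univ.erase ℓ, ∑ j,
            adjEntry G i j / (4 * R.κ i j) * (g i j - α) ^ 2 +
          ∑ i ∈ Finset.univ.erase ℓ, ∑ j, 1 / 4 * (adjEntry G i j * R.ϱ i j * α ^ 2)) := by
    rw [Protocol.lyapunovDeriv, Finset.sum_add_distrib]
    simp only [hstate]
    rw [Finset.sum_sub_distrib, ← Finset.mul_sum]
    refine add_le_add_right ((Finset.sum_le_sum fun i hi => Finset.sum_le_sum fun j _ =>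
      hgain i hi j).trans (le_of_eq ?_)) _
    simp only [disagreement, nodeDisagreement, Finset.mul_sum, Finset.sum_add_distrib,
      Finset.sum_sub_distrib]
  have hcard : ((Finset.univ.erase ℓ).card : ℝ) ≤ Fintype.card V := by
    exact_mod_cast Finset.card_le_univ _
  have herr' : 2 * ∑ i ∈ Finset.univ.erase ℓ, totalGain G (g i) i * quadForm R.Γ (Y i - X i) +
      ∑ i ∈ Finset.univ.erase ℓ, (quadForm R.Γ (X i - X ℓ) - (X i - X ℓ) ⬝ᵥ (X i - X ℓ)) ≤
      -- Each follower's error bound contains the total disagreement, so summation multiplies L and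
      -- C by at most the number of agents.
      K * ∑ i ∈ Finset.univ.erase ℓ, quadForm P (X i - X ℓ) +
        Fintype.card V * (L * disagreement G ℓ R.Γ Y + C) := by
    have h1 : ∀ i ∈ Finset.univ.erase ℓ,
        2 * (totalGain G (g i) i * quadForm R.Γ (Y i - X i)) +
          (quadForm R.Γ (X i - X ℓ) - (X i - X ℓ) ⬝ᵥ (X i - X ℓ)) ≤
        K * quadForm P (X i - X ℓ) + (L * disagreement G ℓ R.Γ Y + C) := fun i hi => by
      linarith [herr i (Finset.ne_of_mem_erase hi), hβ (X i - X ℓ)]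
    have h2 := Finset.sum_le_sum h1
    rw [Finset.sum_add_distrib, Finset.sum_add_distrib, ← Finset.mul_sum, ← Finset.mul_sum,
      Finset.sum_const, nsmul_eq_mul] at h2
    have h3 := mul_le_mul_of_nonneg_right hcard
      (by positivity : 0 ≤ L * disagreement G ℓ R.Γ Y + C)
    linarith
  have hα' := mul_le_mul_of_nonneg_right hα hD
  rw [Protocol.lyapunov, Finset.sum_add_distrib]
  linarith

end Lyapunov

/-! ### Consequences of a negative triggering function -/

section Trigger

variable {V : Type*} [Fintype V] [DecidableEq V] {n p : ℕ}

/-- The coefficient of the squared measurement error in the triggering function. -/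
noncomputable def Protocol.triggerWeight (R : Protocol V n p) (G : Digraph V) (ℓ i : V)
    (g : V → ℝ) : ℝ :=
  1 / 2 * (1 + R.δ * g ℓ) * adjEntry G i ℓ +
    ∑ j ∈ Finset.univ.erase ℓ, (1 + R.δ * g j) * adjEntry G i j

variable {G : Digraph V} {ℓ : V} {R : Protocol V n p}

theorem Protocol.trigger_eq (R : Protocol V n p) (i : V) (w : Fin n → ℝ) (y : V → Fin n → ℝ)
    (ξ : Fin n → ℝ) (g : V → ℝ) (t : ℝ) :
    R.trigger G ℓ i w y ξ g t = R.triggerWeight G ℓ i g * quadForm R.Γ (w - ξ) -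
      1 / 4 * ∑ j, adjEntry G i j * quadForm R.Γ (w - y j) - R.μ * Real.exp (-R.ν * t) -
      1 / 2 * (adjEntry G i ℓ * quadForm R.Γ (w - y ℓ)) := by
  rw [Protocol.trigger, Protocol.triggerWeight, add_mul, Finset.sum_mul]
  ring

/-- The factor 3/4 is 1/4 from the sum over neighbors plus 1/2 from the separate leader term. -/
theorem Protocol.triggerWeight_mul_le (hR : R.Admissible G ℓ) (hq : ∀ v, 0 ≤ quadForm R.Γ v)
    {i : V} {X : Fin n → ℝ} {Y : V → Fin n → ℝ} {g : V → ℝ} {t : ℝ} (ht : 0 ≤ t)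
    (h : R.trigger G ℓ i (Y i) Y X g t < 0) :
    R.triggerWeight G ℓ i g * quadForm R.Γ (Y i - X) ≤
      3 / 4 * nodeDisagreement G R.Γ Y i + R.μ := by
  rw [Protocol.trigger_eq] at h
  have h1 := adjEntry_mul_le_nodeDisagreement (G := G) hq Y i ℓ
  have h2 : R.μ * Real.exp (-R.ν * t) ≤ R.μ :=
    mul_le_of_le_one_right hR.μ_pos.le (Real.exp_le_one_iff.mpr (by
      nlinarith [mul_nonneg hR.ν_pos.le ht]))
  change _ - 1 / 4 * nodeDisagreement G R.Γ Y i - _ - _ < 0 at h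
  linarith

/-- Makes the trigger usable: it controls the weight times the squared error, while the Lyapunov
estimate needs the total gain times it. The parameter c in the proof is the weight 1/2 of the
leader's edge or 1 of a follower's. -/
theorem Protocol.totalGain_le (hR : R.Admissible G ℓ) {i : V} {g : V → ℝ} {m : ℝ} (hm : 0 ≤ m)
    (hg : ∀ j, G.Adj j i → -m ≤ g j) :
    totalGain G g i ≤ 2 / R.δ * R.triggerWeight G ℓ i g + Fintype.card V * (3 * m) := by
  have hδ := hR.δ_pos
  have hterm : ∀ j, ∀ c : ℝ, c = 1 / 2 ∨ c = 1 → adjEntry G i j * |g j| ≤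
      2 / R.δ * (c * (1 + R.δ * g j) * adjEntry G i j) + 3 * m := by
    intro j c hc
    by_cases h : G.Adj j i
    · rw [adjEntry_of_adj h]
      have h1 := hg j h
      have h2 : |g j| ≤ g j + 2 * m := abs_le.mpr ⟨by linarith, by linarith⟩
      have h3 : 2 / R.δ * (c * (1 + R.δ * g j) * 1) = c * (2 / R.δ) + 2 * c * g j := by
        field_simp
      have h4 : 0 < 2 / R.δ := by positivity
      rcases hc with rfl | rfl <;> linarith
    · simp only [adjEntry, if_neg h]
      linarith
  rw [totalGain, ← Finset.add_sum_erase _ _ (Finset.mem_univ ℓ)]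
  have h1 := hterm ℓ (1 / 2) (Or.inl rfl)
  have h2 := Finset.sum_le_sum fun j (_ : j ∈ Finset.univ.erase ℓ) => hterm j 1 (Or.inr rfl)
  have hcard : ((Finset.univ.erase ℓ).card : ℝ) + 1 = Fintype.card V := by
    exact_mod_cast Finset.card_erase_add_one (Finset.mem_univ ℓ)
  rw [Finset.sum_add_distrib, ← Finset.mul_sum, Finset.sum_const, nsmul_eq_mul] at h2
  simp only [one_mul] at h2
  rw [← hcard, Protocol.triggerWeight, mul_add]
  linarith

/-- The threshold -1/(2δ) is exactly where |g| ≤ (1 + δg)/δ starts to hold, so no additive constant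
remains. -/
theorem Protocol.totalGain_le_of_neg_le (hR : R.Admissible G ℓ) {i : V} {g : V → ℝ}
    (hg : ∀ j, G.Adj j i → -(1 / (2 * R.δ)) ≤ g j) :
    totalGain G g i ≤ 2 / R.δ * R.triggerWeight G ℓ i g := by
  have hδ := hR.δ_pos
  have hterm : ∀ j, ∀ c : ℝ, c = 1 / 2 ∨ c = 1 → adjEntry G i j * |g j| ≤
      2 / R.δ * (c * (1 + R.δ * g j) * adjEntry G i j) := by
    intro j c hc
    by_cases h : G.Adj j i
    · rw [adjEntry_of_adj h]
      have h1 := hg j h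
      have h0 : 1 / R.δ = 2 * (1 / (2 * R.δ)) := by field_simp
      have h4 : 0 < 1 / (2 * R.δ) := by positivity
      have h2 : |g j| ≤ g j + 1 / R.δ := abs_le.mpr ⟨by linarith, by linarith⟩
      have h3 : 2 / R.δ * (c * (1 + R.δ * g j) * 1) = c * (2 * (1 / R.δ)) + 2 * c * g j := by
        field_simp
      rcases hc with rfl | rfl <;> linarith
    · simp [adjEntry, h]
  rw [totalGain, ← Finset.add_sum_erase _ _ (Finset.mem_univ ℓ), Protocol.triggerWeight, mul_add,
    Finset.mul_sum]
  refine add_le_add (hterm ℓ (1 / 2) (Or.inl rfl)) (Finset.sum_le_sum fun j _ => ?_)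
  simpa using hterm j 1 (Or.inr rfl)

/-- Reachability gives each follower an incoming edge; its factor 1 + δg is at least 1/2, halved
once more if the edge comes from the leader. -/
theorem Protocol.le_triggerWeight (hG : IsLeaderFollowerGraph G ℓ) (hR : R.Admissible G ℓ) {i : V}
    (hi : i ≠ ℓ) {g : V → ℝ} (hg : ∀ j, G.Adj j i → -(1 / (2 * R.δ)) ≤ g j) :
    1 / 4 ≤ R.triggerWeight G ℓ i g := by
  have hδ := hR.δ_pos
  have hone : ∀ j, G.Adj j i → 1 / 2 ≤ 1 + R.δ * g j := fun j h => by
    have h1 := mul_le_mul_of_nonneg_left (hg j h) hδ.le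
    have h2 : R.δ * -(1 / (2 * R.δ)) = -(1 / 2) := by field_simp
    linarith
  have hnn : ∀ j, 0 ≤ (1 + R.δ * g j) * adjEntry G i j := fun j => by
    by_cases h : G.Adj j i
    · rw [adjEntry_of_adj h]
      linarith [hone j h]
    · simp [adjEntry, h]
  have hsum : 0 ≤ ∑ j ∈ Finset.univ.erase ℓ, (1 + R.δ * g j) * adjEntry G i j :=
    Finset.sum_nonneg fun j _ => hnn j
  obtain ⟨j, hji⟩ : ∃ j, G.Adj j i := by
    rcases Relation.ReflTransGen.cases_tail (hG.rooted i) with h | ⟨j, -, h⟩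
    · exact absurd h hi
    · exact ⟨j, h⟩
  have hj := hone j hji
  rw [Protocol.triggerWeight]
  rcases eq_or_ne j ℓ with rfl | hjℓ
  · rw [adjEntry_of_adj hji]
    linarith
  · have h1 := Finset.single_le_sum (fun j _ => hnn j)
      (Finset.mem_erase.mpr ⟨hjℓ, Finset.mem_univ j⟩)
    rw [adjEntry_of_adj hji] at h1
    linarith [hnn ℓ]

/-- Error bound for gains bounded below by an arbitrary constant. -/
theorem Protocol.exists_error_bound (hG : IsLeaderFollowerGraph G ℓ) (hR : R.Admissible G ℓ)
    (hΓ : R.Γᵀ = R.Γ) (hq : ∀ v, 0 ≤ quadForm R.Γ v) {m : ℝ} (hm : 0 ≤ m) :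
    ∃ β L C : ℝ, 0 ≤ β ∧ 0 ≤ L ∧ 0 ≤ C ∧ ∀ (X Y : V → Fin n → ℝ) (g : V → V → ℝ) (t : ℝ),
      0 ≤ t → Y ℓ = X ℓ → ∀ i, i ≠ ℓ → (∀ j, G.Adj j i → -m ≤ g i j) →
      R.trigger G ℓ i (Y i) Y (X i) (g i) t < 0 →
      2 * (totalGain G (g i) i * quadForm R.Γ (Y i - X i)) + quadForm R.Γ (X i - X ℓ) ≤
        β * ((X i - X ℓ) ⬝ᵥ (X i - X ℓ)) + L * disagreement G ℓ R.Γ Y + C := by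
  obtain ⟨Cg, hCg, hdis⟩ := exists_quadForm_sub_le_disagreement hG hΓ hq
  obtain ⟨CΓ, hCΓ, hquad⟩ := exists_quadForm_le R.Γ
  have hδ := hR.δ_pos
  have hμ := hR.μ_pos
  obtain ⟨M, hM⟩ : ∃ M, M = 2 / R.δ + Fintype.card V * (3 * m) := ⟨_, rfl⟩
  have hδ2 : 0 < 2 / R.δ := by positivity
  have hNm : 0 ≤ Fintype.card V * (3 * m) := by positivity
  have hM0 : 0 ≤ M := by rw [hM]; positivity
  refine ⟨(4 * M + 1) * CΓ, 2 * M * (2 * Cg + 3 / 4), 2 * M * R.μ, by positivity, by positivity,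
    by positivity, fun X Y g t ht hY i hi hg htr => ?_⟩
  have h1 := R.triggerWeight_mul_le hR hq ht htr
  have h2 := R.totalGain_le hR hm hg
  have h3 := nodeDisagreement_le (G := G) hq Y hi
  have h4 := hq (Y i - X i)
  have h5 := disagreement_nonneg (G := G) (ℓ := ℓ) hq Y
  have h6 := nodeDisagreement_nonneg (G := G) hq Y i
  have h7 := hq (X i - X ℓ)
  have h8 := mul_nonneg hCg h5
  have hW : totalGain G (g i) i * quadForm R.Γ (Y i - X i) ≤
      M * (2 * quadForm R.Γ (X i - X ℓ) + 2 * (Cg * disagreement G ℓ R.Γ Y) +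
        3 / 4 * disagreement G ℓ R.Γ Y + R.μ) := by
    -- A small or negative weight makes the trigger useless, but then the gains are bounded by M and
    -- the error is estimated by the triangle inequality. A weight above 1 dominates the gains up to
    -- the factor M.
    rcases le_total (R.triggerWeight G ℓ i (g i)) 1 with hs | hs
    · have hgain : totalGain G (g i) i ≤ M := by
        rw [hM]
        nlinarith
      have he : quadForm R.Γ (Y i - X i) ≤
          2 * quadForm R.Γ (X i - X ℓ) + 2 * (Cg * disagreement G ℓ R.Γ Y) := by
        have e : Y i - X i = -(X i - X ℓ) + (Y i - Y ℓ) := by rw [hY]; abel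
        have := quadForm_add_le hΓ hq (-(X i - X ℓ)) (Y i - Y ℓ)
        rw [quadForm_neg, ← e] at this
        linarith [hdis Y i]
      exact mul_le_mul hgain (by linarith) h4 hM0
    · have hgain : totalGain G (g i) i ≤ M * R.triggerWeight G ℓ i (g i) := by
        rw [hM]
        nlinarith
      calc totalGain G (g i) i * quadForm R.Γ (Y i - X i)
          ≤ M * R.triggerWeight G ℓ i (g i) * quadForm R.Γ (Y i - X i) :=
            mul_le_mul_of_nonneg_right hgain h4
        _ = M * (R.triggerWeight G ℓ i (g i) * quadForm R.Γ (Y i - X i)) := mul_assoc _ _ _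
        _ ≤ _ := mul_le_mul_of_nonneg_left (by linarith) hM0
  have h9 := mul_le_mul_of_nonneg_left (hquad (X i - X ℓ)) (by positivity : 0 ≤ 4 * M + 1)
  linarith

/-- Error bound, independent of the tracking errors, for gains that are at most slightly
negative. -/
theorem Protocol.exists_error_bound_of_neg_le (hG : IsLeaderFollowerGraph G ℓ)
    (hR : R.Admissible G ℓ) (hΓ : R.Γᵀ = R.Γ) (hq : ∀ v, 0 ≤ quadForm R.Γ v) :
    ∃ L C : ℝ, 0 ≤ L ∧ 0 ≤ C ∧ ∀ (X Y : V → Fin n → ℝ) (g : V → V → ℝ) (t : ℝ),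
      0 ≤ t → Y ℓ = X ℓ → ∀ i, i ≠ ℓ → (∀ j, G.Adj j i → -(1 / (2 * R.δ)) ≤ g i j) →
      R.trigger G ℓ i (Y i) Y (X i) (g i) t < 0 →
      2 * (totalGain G (g i) i * quadForm R.Γ (Y i - X i)) + quadForm R.Γ (X i - X ℓ) ≤
        L * disagreement G ℓ R.Γ Y + C := by
  obtain ⟨Cg, hCg, hdis⟩ := exists_quadForm_sub_le_disagreement hG hΓ hq
  have hδ := hR.δ_pos
  have hμ := hR.μ_pos
  have hδ2 : 0 < 2 / R.δ := by positivity
  -- The 8 is the factor 2 of `quadForm_add_le` divided by the lower bound 1/4 of the weight; 2 ·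
  -- (2/δ) comes from the total gain.
  refine ⟨2 * Cg + (8 + 2 * (2 / R.δ)) * (3 / 4), (8 + 2 * (2 / R.δ)) * R.μ, by positivity,
    by positivity, fun X Y g t ht hY i hi hg htr => ?_⟩
  have h1 := R.triggerWeight_mul_le hR hq ht htr
  have h2 := R.totalGain_le_of_neg_le hR hg
  have h3 := nodeDisagreement_le (G := G) hq Y hi
  have h4 := hq (Y i - X i)
  have h5 := mul_le_mul_of_nonneg_right (R.le_triggerWeight hG hR hi hg) h4
  have h6 := mul_le_mul_of_nonneg_right h2 h4
  rw [mul_assoc] at h6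
  have h7 : R.triggerWeight G ℓ i (g i) * quadForm R.Γ (Y i - X i) ≤
      3 / 4 * disagreement G ℓ R.Γ Y + R.μ := by linarith
  have h8 := mul_le_mul_of_nonneg_left h7 hδ2.le
  have he : quadForm R.Γ (X i - X ℓ) ≤
      2 * quadForm R.Γ (Y i - Y ℓ) + 2 * quadForm R.Γ (Y i - X i) := by
    have e : X i - X ℓ = (Y i - Y ℓ) + -(Y i - X i) := by rw [hY]; abel
    rw [e]
    exact (quadForm_add_le hΓ hq _ _).trans (by rw [quadForm_neg])
  linarith [hdis Y i]

end Trigger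

/-! ### Closed-loop evolutions -/

theorem Icc_subset_horizon {t₀ : ℝ} {T : EReal} {a b : ℝ} (ha : t₀ ≤ a) (hb : (b : EReal) < T) :
    Set.Icc a b ⊆ {t : ℝ | t₀ ≤ t ∧ (t : EReal) < T} := fun _ ht =>
  ⟨ha.trans ht.1, (EReal.coe_le_coe_iff.mpr ht.2).trans_lt hb⟩

namespace Evolution

theorem trackingError_sq {V : Type*} {n : ℕ} (S : Evolution V n) (ℓ i : V) (t : ℝ) :
    S.trackingError ℓ i t ^ 2 = (S.x i t - S.x ℓ t) ⬝ᵥ (S.x i t - S.x ℓ t) := by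
  rw [trackingError, EuclideanSpace.norm_sq_eq, sum_sq_eq_dotProduct]
  simp

variable {V : Type*} [Fintype V] [DecidableEq V] {n p : ℕ} {G : Digraph V} {ℓ : V}
  {A : Matrix (Fin n) (Fin n) ℝ} {B : Matrix (Fin n) (Fin p) ℝ} {P : Matrix (Fin n) (Fin n) ℝ}
  {R : Protocol V n p} {S : Evolution V n} {t₀ : ℝ} {T : EReal}

/-- State and prediction solve the same linear equation from the same initial value; uniqueness
needs only right derivatives. -/
theorem IsClosedLoop.xt_leader_eq (hS : S.IsClosedLoop G ℓ A B R t₀ T) {t : ℝ} (h0 : t₀ ≤ t)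
    (hT : (t : EReal) < T) : S.xt ℓ t = S.x ℓ t := by
  have hsub := Icc_subset_horizon (le_refl t₀) hT
  have hcont : ContinuousOn (fun s => S.x ℓ s - predict A t₀ (S.x ℓ t₀) s) (Set.Icc t₀ t) :=
    ((hS.x_cont ℓ).mono hsub).sub fun s _ =>
      (hasDerivAt_predict A t₀ (S.x ℓ t₀) s).continuousAt.continuousWithinAt
  have hderiv : ∀ s ∈ Set.Ico t₀ t,
      HasDerivWithinAt (fun s => S.x ℓ s - predict A t₀ (S.x ℓ t₀) s)
        (A *ᵥ (S.x ℓ s - predict A t₀ (S.x ℓ t₀) s)) (Set.Ici s) s := fun s hs => by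
    have hs' := hsub ⟨hs.1, hs.2.le⟩
    rw [mulVec_sub]
    exact (hS.leader s hs'.1 hs'.2).sub (hasDerivAt_predict A t₀ (S.x ℓ t₀) s).hasDerivWithinAt
  have h := eq_zero_of_abs_deriv_le_mul_abs_self_of_eq_zero_right hcont hderiv (by simp)
    (K := ‖LinearMap.toContinuousLinearMap A.mulVecLin‖)
    (fun s _ => (LinearMap.toContinuousLinearMap A.mulVecLin).le_opNorm _) t ⟨h0, le_rfl⟩
  rw [hS.xt_leader t h0 hT]
  exact (sub_eq_zero.mp h).symm

/-- The common drive cancels, so the difference of the two gains solves a homogeneous linear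
equation with zero initial value. -/
theorem IsClosedLoop.gain_comm (hS : S.IsClosedLoop G ℓ A B R t₀ T)
    (hG : IsLeaderFollowerGraph G ℓ) (hR : R.Admissible G ℓ) {i j : V} (hi : i ≠ ℓ) (hj : j ≠ ℓ)
    (hadj : G.Adj j i) {t : ℝ} (h0 : t₀ ≤ t) (hT : (t : EReal) < T) :
    S.c i j t = S.c j i t := by
  have hsub := Icc_subset_horizon (le_refl t₀) hT
  have hcont : ContinuousOn (fun s => S.c i j s - S.c j i s) (Set.Icc t₀ t) :=
    ((hS.c_cont i j hi).mono hsub).sub ((hS.c_cont j i hj).mono hsub)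
  have hderiv : ∀ s ∈ Set.Ico t₀ t, HasDerivWithinAt (fun s => S.c i j s - S.c j i s)
      (-(R.κ i j * R.ϱ i j) * (S.c i j s - S.c j i s)) (Set.Ici s) s := fun s hs => by
    have hs' := hsub ⟨hs.1, hs.2.le⟩
    refine ((hS.gain i j hi s hs'.1 hs'.2).sub (hS.gain j i hj s hs'.1 hs'.2)).congr_deriv ?_
    rw [← hR.κ_symm i j hi hj hadj, ← hR.ϱ_symm i j hi hj hadj, adjEntry_of_adj hadj,
      adjEntry_of_adj (hG.undirected _ _ hj hi hadj), quadForm_sub_comm R.Γ (S.xt j s)]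
    ring
  have h := eq_zero_of_abs_deriv_le_mul_abs_self_of_eq_zero_right hcont hderiv
    (by rw [hS.gain_symm i j hi hj hadj, sub_self]) (K := |-(R.κ i j * R.ϱ i j)|)
    (fun s _ => by rw [norm_mul]; rfl) t ⟨h0, le_rfl⟩
  exact sub_eq_zero.mp h

/-- Negative gains decay exponentially. -/
theorem IsClosedLoop.neg_exp_le_gain (hS : S.IsClosedLoop G ℓ A B R t₀ T)
    (hR : R.Admissible G ℓ) (hq : ∀ v, 0 ≤ quadForm R.Γ v) {i j : V} (hi : i ≠ ℓ)
    (hadj : G.Adj j i) {a : ℝ} (ha : -a ≤ S.c i j t₀) {t : ℝ} (h0 : t₀ ≤ t)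
    (hT : (t : EReal) < T) :
    -(a * Real.exp (-(R.κ i j * R.ϱ i j) * (t - t₀))) ≤ S.c i j t := by
  have hsub := Icc_subset_horizon (le_refl t₀) hT
  have h := le_gronwallBound_of_hasDerivWithinAt_Ici (f := fun s => -S.c i j s)
    (K := -(R.κ i j * R.ϱ i j)) (C := 0) (v := a) ((hS.c_cont i j hi).mono hsub).neg
    (fun s hs => (hS.gain i j hi s (hsub ⟨hs.1, hs.2.le⟩).1 (hsub ⟨hs.1, hs.2.le⟩).2).neg)
    (by linarith) (fun s _ => by
      rw [adjEntry_of_adj hadj]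
      nlinarith [mul_nonneg (hR.κ_pos i j hi hadj).le (hq (S.xt i s - S.xt j s))])
    t ⟨h0, le_rfl⟩
  rw [gronwallBound_ε0] at h
  linarith

theorem IsClosedLoop.hasDerivWithinAt_lyapunov (hS : S.IsClosedLoop G ℓ A B R t₀ T)
    (hP : Pᵀ = P) (α : ℝ) {t : ℝ} (h0 : t₀ ≤ t) (hT : (t : EReal) < T) :
    HasDerivWithinAt (fun s => R.lyapunov G ℓ P α (fun i => S.x i s) fun i j => S.c i j s)
      (R.lyapunovDeriv G ℓ A B P α (fun i => S.x i t) (fun i => S.xt i t) fun i j => S.c i j t)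
      (Set.Ici t) t := by
  refine HasDerivWithinAt.fun_sum fun i hi => ?_
  have hi' := Finset.ne_of_mem_erase hi
  refine HasDerivWithinAt.add (hasDerivWithinAt_quadForm hP
    ((hS.follower i hi' t h0 hT).sub (hS.leader t h0 hT))) ?_
  refine HasDerivWithinAt.fun_sum fun j _ => HasDerivWithinAt.const_mul _ ?_
  exact (((hS.gain i j hi' t h0 hT).sub_const α).pow 2).congr_deriv (by simp)

theorem IsClosedLoop.continuousOn_lyapunov (hS : S.IsClosedLoop G ℓ A B R t₀ T) (α : ℝ) :
    ContinuousOn (fun s => R.lyapunov G ℓ P α (fun i => S.x i s) fun i j => S.c i j s)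
      {t | t₀ ≤ t ∧ (t : EReal) < T} := by
  refine continuousOn_finsetSum _ fun i hi => ?_
  have hi' := Finset.ne_of_mem_erase hi
  refine ContinuousOn.add ?_ (continuousOn_finsetSum _ fun j _ =>
    continuousOn_const.mul (((hS.c_cont i j hi').sub continuousOn_const).pow 2))
  have hquad : Continuous fun v : Fin n → ℝ => quadForm P v := by
    unfold quadForm
    fun_prop
  exact hquad.comp_continuousOn ((hS.x_cont i).sub (hS.x_cont ℓ))

/-- The Lyapunov function grows at most as dictated by the linear comparison equation. -/
theorem IsClosedLoop.lyapunov_le (hS : S.IsClosedLoop G ℓ A B R t₀ T)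
    (hG : IsLeaderFollowerGraph G ℓ) (hP : Pᵀ = P)
    (hARE : P * A + Aᵀ * P - P * B * Bᵀ * P + 1 = 0) (hR : R.Admissible G ℓ)
    (hK : R.K = -(Bᵀ * P)) (hΓ : R.Γ = P * B * Bᵀ * P) {m β L C K : ℝ} (hm : 0 ≤ m)
    (hβ : ∀ v : Fin n → ℝ, (β - 1) * (v ⬝ᵥ v) ≤ K * quadForm P v)
    (hϱ : ∀ i j, i ≠ ℓ → G.Adj j i → -(R.ϱ i j * R.κ i j) ≤ K) (hL : 0 ≤ L) (hC : 0 ≤ C)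
    (herr : ∀ (X Y : V → Fin n → ℝ) (g : V → V → ℝ) (t : ℝ),
      0 ≤ t → Y ℓ = X ℓ → ∀ i, i ≠ ℓ → (∀ j, G.Adj j i → -m ≤ g i j) →
      R.trigger G ℓ i (Y i) Y (X i) (g i) t < 0 →
      2 * (totalGain G (g i) i * quadForm R.Γ (Y i - X i)) + quadForm R.Γ (X i - X ℓ) ≤
        β * ((X i - X ℓ) ⬝ᵥ (X i - X ℓ)) + L * disagreement G ℓ R.Γ Y + C)
    {α : ℝ} (hα : α = 2 * (2 * m + Fintype.card V * L)) {t₁ v : ℝ} (ht₀ : 0 ≤ t₀)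
    (h1 : t₀ ≤ t₁)
    (hg : ∀ s : ℝ, t₁ ≤ s → (s : EReal) < T → ∀ i j, i ≠ ℓ → G.Adj j i → -m ≤ S.c i j s)
    (hv : R.lyapunov G ℓ P α (fun i => S.x i t₁) (fun i j => S.c i j t₁) ≤ v)
    {t : ℝ} (ht : t₁ ≤ t) (hT : (t : EReal) < T) :
    R.lyapunov G ℓ P α (fun i => S.x i t) (fun i j => S.c i j t) ≤
      gronwallBound v K (Fintype.card V * C +
        ∑ i ∈ Finset.univ.erase ℓ, ∑ j, 1 / 4 * (adjEntry G i j * R.ϱ i j * α ^ 2)) (t - t₁) := by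
  have hsub := Icc_subset_horizon h1 hT
  refine le_gronwallBound_of_hasDerivWithinAt_Ici
    (f := fun s => R.lyapunov G ℓ P α (fun i => S.x i s) fun i j => S.c i j s)
    (f' := fun s => R.lyapunovDeriv G ℓ A B P α (fun i => S.x i s) (fun i => S.xt i s)
      fun i j => S.c i j s)
    ((hS.continuousOn_lyapunov α).mono hsub)
    (fun s hs => hS.hasDerivWithinAt_lyapunov hP α (hsub ⟨hs.1, hs.2.le⟩).1
      (hsub ⟨hs.1, hs.2.le⟩).2) hv (fun s hs => ?_) t ⟨ht, le_rfl⟩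
  obtain ⟨hs0, hsT⟩ := hsub ⟨hs.1, hs.2.le⟩
  have herr' : ∀ i, i ≠ ℓ →
      2 * (totalGain G (fun j => S.c i j s) i * quadForm R.Γ (S.xt i s - S.x i s)) +
        quadForm R.Γ (S.x i s - S.x ℓ s) ≤
      β * ((S.x i s - S.x ℓ s) ⬝ᵥ (S.x i s - S.x ℓ s)) +
        L * disagreement G ℓ R.Γ (fun i => S.xt i s) + C := fun i hi =>
    herr (fun i => S.x i s) (fun i => S.xt i s) (fun i j => S.c i j s) s (ht₀.trans hs0)
      (hS.xt_leader_eq hs0 hsT) i hi (fun j h => hg s hs.1 hsT i j hi h) (hS.no_miss i hi s hs0 hsT)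
  exact R.lyapunovDeriv_le (X := fun i => S.x i s) (Y := fun i => S.xt i s)
    (g := fun i j => S.c i j s) hG hP hARE hR hK hΓ hm hβ hϱ hα.ge hL hC
    (hS.xt_leader_eq hs0 hsT) (hg s hs.1 hsT)
    (fun i j hi hj h => hS.gain_comm hG hR hi hj h hs0 hsT) herr'

/-! ### Bounds in terms of the Lyapunov function -/

/-- Together with `exists_boundedAt_of_lyapunov_le` this permits passing between Lyapunov functions
with different α. -/
theorem exists_lyapunov_le_of_boundedAt (hR : R.Admissible G ℓ) (P : Matrix (Fin n) (Fin n) ℝ)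
    (α r : ℝ) :
    ∃ v : ℝ, 0 ≤ v ∧ ∀ (S : Evolution V n) (t : ℝ), S.BoundedAt G ℓ r t →
      R.lyapunov G ℓ P α (fun i => S.x i t) (fun i j => S.c i j t) ≤ v := by
  obtain ⟨C, hC, hCP⟩ := exists_quadForm_le P
  have hw : ∀ i ∈ Finset.univ.erase ℓ, ∀ j, 0 ≤ adjEntry G i j / (4 * R.κ i j) := by
    intro i hi j
    by_cases h : G.Adj j i
    · have := hR.κ_pos i j (Finset.ne_of_mem_erase hi) h
      exact div_nonneg (adjEntry_nonneg _ _ _) (by positivity)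
    · simp [adjEntry, h]
  refine ⟨∑ i ∈ Finset.univ.erase ℓ, (C * r ^ 2 +
    ∑ j, adjEntry G i j / (4 * R.κ i j) * (r + |α|) ^ 2), ?_, fun S t hS => ?_⟩
  · exact Finset.sum_nonneg fun i hi => add_nonneg (by positivity)
      (Finset.sum_nonneg fun j _ => mul_nonneg (hw i hi j) (sq_nonneg _))
  refine Finset.sum_le_sum fun i hi => add_le_add ?_ (Finset.sum_le_sum fun j _ => ?_)
  · refine (hCP _).trans (mul_le_mul_of_nonneg_left ?_ hC.le)
    rw [← trackingError_sq]
    exact pow_le_pow_left₀ (norm_nonneg _) (hS.1 i (Finset.ne_of_mem_erase hi)) 2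
  · by_cases h : G.Adj j i
    · refine mul_le_mul_of_nonneg_left ?_ (hw i hi j)
      have h1 := hS.2 i j (Finset.ne_of_mem_erase hi) h
      exact sq_le_sq.mpr ((abs_sub _ _).trans ((add_le_add_left h1 _).trans (le_abs_self _)))
    · simp [adjEntry, h]

theorem exists_boundedAt_of_lyapunov_le (hR : R.Admissible G ℓ) (hP : P.PosDef) (α v : ℝ) :
    ∃ r : ℝ, 0 < r ∧ ∀ (S : Evolution V n) (t : ℝ),
      R.lyapunov G ℓ P α (fun i => S.x i t) (fun i j => S.c i j t) ≤ v →
      S.BoundedAt G ℓ r t := by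
  obtain ⟨q, hq, hqP⟩ := exists_le_quadForm_of_posDef hP
  have hnn : ∀ u, 0 ≤ quadForm P u := fun u =>
    (mul_nonneg hq.le (dotProduct_self_nonneg' u)).trans (hqP u)
  have hw : ∀ i, i ≠ ℓ → ∀ j, G.Adj j i → 0 < R.κ i j := fun i hi j h => hR.κ_pos i j hi h
  have hterm : ∀ i ∈ Finset.univ.erase ℓ, ∀ (g : ℝ) j,
      0 ≤ adjEntry G i j / (4 * R.κ i j) * (g - α) ^ 2 := by
    intro i hi g j
    by_cases h : G.Adj j i
    · have := hw i (Finset.ne_of_mem_erase hi) j h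
      exact mul_nonneg (div_nonneg (adjEntry_nonneg _ _ _) (by positivity)) (sq_nonneg _)
    · simp [adjEntry, h]
  -- Square roots are avoided through s ≤ 1 + s², and the sum over all pairs stands in for a maximum
  -- over edges.
  refine ⟨1 + |v| / q + |α| + ∑ i, ∑ j, 4 * |R.κ i j| * |v|, by positivity, fun S t hS => ?_⟩
  have hsum0 : 0 ≤ ∑ i, ∑ j, 4 * |R.κ i j| * |v| := by positivity
  have hv0 : 0 ≤ |v| / q := by positivity
  have hnode : ∀ i, i ≠ ℓ → quadForm P (S.x i t - S.x ℓ t) +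
      ∑ j, adjEntry G i j / (4 * R.κ i j) * (S.c i j t - α) ^ 2 ≤ |v| := fun i hi =>
    (Finset.single_le_sum (f := fun i => quadForm P (S.x i t - S.x ℓ t) +
      ∑ j, adjEntry G i j / (4 * R.κ i j) * (S.c i j t - α) ^ 2)
      (fun i hi => add_nonneg (hnn _) (Finset.sum_nonneg fun j _ => hterm i hi _ j))
      (Finset.mem_erase.mpr ⟨hi, Finset.mem_univ i⟩)).trans (hS.trans (le_abs_self v))
  constructor
  · intro i hi
    have h1 := hnode i hi
    have h2 : 0 ≤ ∑ j, adjEntry G i j / (4 * R.κ i j) * (S.c i j t - α) ^ 2 :=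
      Finset.sum_nonneg fun j _ => hterm i (Finset.mem_erase.mpr ⟨hi, Finset.mem_univ i⟩) _ j
    have h3 := hqP (S.x i t - S.x ℓ t)
    rw [← trackingError_sq] at h3
    have h4 : S.trackingError ℓ i t ^ 2 ≤ |v| / q := by
      rw [le_div_iff₀ hq]
      linarith
    have h5 : S.trackingError ℓ i t ≤ 1 + S.trackingError ℓ i t ^ 2 := by
      nlinarith [sq_nonneg (S.trackingError ℓ i t - 1)]
    linarith [abs_nonneg α]
  · intro i j hi h
    have hκ := hw i hi j h
    have h1 := hnode i hi
    have h2 := Finset.single_le_sum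
      (fun j _ => hterm i (Finset.mem_erase.mpr ⟨hi, Finset.mem_univ i⟩) (S.c i j t) j)
      (Finset.mem_univ j)
    have h3 : adjEntry G i j / (4 * R.κ i j) * (S.c i j t - α) ^ 2 ≤ |v| := by
      linarith [hnn (S.x i t - S.x ℓ t)]
    rw [adjEntry_of_adj h, one_div_mul_eq_div, div_le_iff₀ (by positivity)] at h3
    have h4 : 4 * |R.κ i j| * |v| ≤ ∑ i, ∑ j, 4 * |R.κ i j| * |v| :=
      (Finset.single_le_sum (f := fun j => 4 * |R.κ i j| * |v|) (fun _ _ => by positivity)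
        (Finset.mem_univ j)).trans (Finset.single_le_sum
          (f := fun i => ∑ j, 4 * |R.κ i j| * |v|) (fun _ _ => by positivity) (Finset.mem_univ i))
    rw [abs_of_pos hκ] at h4
    have h5 : |S.c i j t - α| ≤ 1 + (S.c i j t - α) ^ 2 := by
      nlinarith [sq_nonneg (|S.c i j t - α| - 1), sq_abs (S.c i j t - α)]
    have h6 : |S.c i j t| ≤ |S.c i j t - α| + |α| := by
      simpa using abs_add_le (S.c i j t - α) α
    linarith

end Evolution

/-! ### Uniform ultimate boundedness -/

/-- Since v ≤ e^v, waiting for the time v/γ suffices; both waiting times of the boundedness proof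
come from here. -/
theorem mul_exp_neg_le_one {γ v τ : ℝ} (hγ : 0 < γ) (hτ : v / γ ≤ τ) :
    v * Real.exp (-γ * τ) ≤ 1 := by
  rw [div_le_iff₀ hγ] at hτ
  calc v * Real.exp (-γ * τ) ≤ Real.exp v * Real.exp (-v) :=
        mul_le_mul (by linarith [Real.add_one_le_exp v]) (Real.exp_le_exp.mpr (by linarith))
          (Real.exp_pos _).le (Real.exp_pos _).le
    _ = 1 := by rw [← Real.exp_add, add_neg_cancel, Real.exp_zero]

theorem Protocol.Admissible.exists_rate {V : Type*} [Fintype V] {n p : ℕ} {G : Digraph V} {ℓ : V}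
    {R : Protocol V n p} (hR : R.Admissible G ℓ) :
    ∃ γ : ℝ, 0 < γ ∧ ∀ i j, i ≠ ℓ → G.Adj j i → γ ≤ R.ϱ i j * R.κ i j := by
  -- The summand 1 keeps the value positive without any edges, and the absolute values make the
  -- entries off the edges harmless.
  refine ⟨(1 + ∑ i, ∑ j, |R.ϱ i j * R.κ i j|⁻¹)⁻¹, by positivity, fun i j hi h => ?_⟩
  have hpos := mul_pos (hR.ϱ_pos i j hi h) (hR.κ_pos i j hi h)
  have h1 : |R.ϱ i j * R.κ i j|⁻¹ ≤ ∑ i, ∑ j, |R.ϱ i j * R.κ i j|⁻¹ :=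
    (Finset.single_le_sum (f := fun j => |R.ϱ i j * R.κ i j|⁻¹) (fun _ _ => by positivity)
      (Finset.mem_univ j)).trans (Finset.single_le_sum
        (f := fun i => ∑ j, |R.ϱ i j * R.κ i j|⁻¹) (fun _ _ => by positivity) (Finset.mem_univ i))
  rw [abs_of_pos hpos] at h1
  exact inv_le_of_inv_le₀ hpos (by linarith)

section Boundedness

variable {V : Type*} [Fintype V] [DecidableEq V] {n p : ℕ} {G : Digraph V} {ℓ : V}
  {A : Matrix (Fin n) (Fin n) ℝ} {B : Matrix (Fin n) (Fin p) ℝ} {P : Matrix (Fin n) (Fin n) ℝ}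
  {R : Protocol V n p}

theorem Protocol.Admissible.leakage_nonneg (hR : R.Admissible G ℓ) {C : ℝ} (hC : 0 ≤ C) (α : ℝ) :
    0 ≤ Fintype.card V * C +
      ∑ i ∈ Finset.univ.erase ℓ, ∑ j, 1 / 4 * (adjEntry G i j * R.ϱ i j * α ^ 2) := by
  refine add_nonneg (by positivity) (Finset.sum_nonneg fun i hi => Finset.sum_nonneg fun j _ => ?_)
  by_cases h : G.Adj j i
  · have := hR.ϱ_pos i j (Finset.ne_of_mem_erase hi) h
    rw [adjEntry_of_adj h]
    positivity
  · simp [adjEntry, h]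

/-- On a bounded horizon, the errors and gains are bounded in terms of their initial size, whatever
the signs of the initial gains. -/
theorem exists_boundedAt_of_horizon (hG : IsLeaderFollowerGraph G ℓ) (hP : P.PosDef)
    (hARE : P * A + Aᵀ * P - P * B * Bᵀ * P + 1 = 0) (hR : R.Admissible G ℓ)
    (hK : R.K = -(Bᵀ * P)) (hΓ : R.Γ = P * B * Bᵀ * P) (a h : ℝ) :
    ∃ r : ℝ, 0 < r ∧ ∀ (t₀ : ℝ) (T : EReal) (S : Evolution V n), 0 ≤ t₀ →
      S.IsClosedLoop G ℓ A B R t₀ T → S.BoundedAt G ℓ a t₀ →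
      ∀ t : ℝ, t₀ ≤ t → t ≤ t₀ + h → (t : EReal) < T → S.BoundedAt G ℓ r t := by
  have hPt : Pᵀ = P := by simpa using hP.isHermitian.eq
  have hq := R.quadForm_Γ_nonneg hPt hΓ
  obtain ⟨β, L, C, hβ, hL, hC, herr⟩ :=
    R.exists_error_bound hG hR (R.transpose_Γ hPt hΓ) hq (abs_nonneg a)
  obtain ⟨q, hq0, hqP⟩ := exists_le_quadForm_of_posDef hP
  obtain ⟨α, hα⟩ : ∃ α, α = 2 * (2 * |a| + Fintype.card V * L) := ⟨_, rfl⟩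
  obtain ⟨v, hv, hvS⟩ := Evolution.exists_lyapunov_le_of_boundedAt hR P α a
  obtain ⟨r, hr, hrS⟩ := Evolution.exists_boundedAt_of_lyapunov_le hR hP α
    (gronwallBound v (β / q) (Fintype.card V * C +
      ∑ i ∈ Finset.univ.erase ℓ, ∑ j, 1 / 4 * (adjEntry G i j * R.ϱ i j * α ^ 2)) h)
  refine ⟨r, hr, fun t₀ T S ht₀ hS ha t h0 hth hT => hrS S t ?_⟩
  have hKP : ∀ v : Fin n → ℝ, (β - 1) * (v ⬝ᵥ v) ≤ β / q * quadForm P v := fun v => by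
    have h1 := mul_le_mul_of_nonneg_left (hqP v) (div_nonneg hβ hq0.le)
    rw [← mul_assoc, div_mul_cancel₀ _ hq0.ne'] at h1
    linarith [dotProduct_self_nonneg' v]
  have hϱ : ∀ i j, i ≠ ℓ → G.Adj j i → -(R.ϱ i j * R.κ i j) ≤ β / q := fun i j hi h =>
    (neg_nonpos.mpr (mul_pos (hR.ϱ_pos i j hi h) (hR.κ_pos i j hi h)).le).trans
      (div_nonneg hβ hq0.le)
  have hg : ∀ s : ℝ, t₀ ≤ s → (s : EReal) < T → ∀ i j, i ≠ ℓ → G.Adj j i →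
      -|a| ≤ S.c i j s := fun s hs hsT i j hi h => by
    refine le_trans (neg_le_neg (mul_le_of_le_one_right (abs_nonneg a) ?_))
      (hS.neg_exp_le_gain hR hq hi h (a := |a|)
        (neg_le_of_abs_le ((ha.2 i j hi h).trans (le_abs_self a))) hs hsT)
    rw [Real.exp_le_one_iff]
    nlinarith [mul_nonneg (mul_pos (hR.κ_pos i j hi h) (hR.ϱ_pos i j hi h)).le (sub_nonneg.mpr hs)]
  refine (hS.lyapunov_le hG hPt hARE hR hK hΓ (abs_nonneg a) hKP hϱ hL hC herr hα ht₀ le_rfl hg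
    (hvS S t₀ ha) h0 hT).trans ?_
  exact gronwallBound_mono hv (hR.leakage_nonneg hC α) (div_nonneg hβ hq0.le) (by linarith)

/-- Once the gains are at most slightly negative, the errors and gains enter a fixed ball after a
time that depends only on their size. -/
theorem exists_ultimate_bound_of_neg_le (hG : IsLeaderFollowerGraph G ℓ) (hP : P.PosDef)
    (hARE : P * A + Aᵀ * P - P * B * Bᵀ * P + 1 = 0) (hR : R.Admissible G ℓ)
    (hK : R.K = -(Bᵀ * P)) (hΓ : R.Γ = P * B * Bᵀ * P) :
    ∃ b : ℝ, 0 < b ∧ ∀ r : ℝ, ∃ θ : ℝ, 0 ≤ θ ∧ ∀ (t₀ : ℝ) (T : EReal) (S : Evolution V n) (t₁ : ℝ),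
      0 ≤ t₀ → S.IsClosedLoop G ℓ A B R t₀ T → t₀ ≤ t₁ →
      (∀ s : ℝ, t₁ ≤ s → (s : EReal) < T → ∀ i j, i ≠ ℓ → G.Adj j i →
        -(1 / (2 * R.δ)) ≤ S.c i j s) →
      S.BoundedAt G ℓ r t₁ → ∀ t : ℝ, t₁ + θ ≤ t → (t : EReal) < T → S.BoundedAt G ℓ b t := by
  have hPt : Pᵀ = P := by simpa using hP.isHermitian.eq
  have hq := R.quadForm_Γ_nonneg hPt hΓ
  have hδ := hR.δ_pos
  have hm : 0 ≤ 1 / (2 * R.δ) := by positivity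
  obtain ⟨L, C, hL, hC, herr⟩ :=
    R.exists_error_bound_of_neg_le hG hR (R.transpose_Γ hPt hΓ) hq
  obtain ⟨q, hq0, hqP⟩ := exists_quadForm_le P
  obtain ⟨γ', hγ', hrate⟩ := hR.exists_rate
  -- The decay rate is limited by the states, through γ·P(v) ≤ |v|², and by the leakage of the
  -- gains.
  obtain ⟨γ, hγ, hγq, hγγ⟩ : ∃ γ : ℝ, 0 < γ ∧ γ * q ≤ 1 ∧ γ ≤ γ' :=
    ⟨min q⁻¹ γ', lt_min (inv_pos.mpr hq0) hγ',
      (mul_le_mul_of_nonneg_right (min_le_left _ _) hq0.le).trans (inv_mul_cancel₀ hq0.ne').le,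
      min_le_right _ _⟩
  obtain ⟨α, hα⟩ : ∃ α, α = 2 * (2 * (1 / (2 * R.δ)) + Fintype.card V * L) := ⟨_, rfl⟩
  obtain ⟨E, hE⟩ : ∃ E, E = Fintype.card V * C +
    ∑ i ∈ Finset.univ.erase ℓ, ∑ j, 1 / 4 * (adjEntry G i j * R.ϱ i j * α ^ 2) := ⟨_, rfl⟩
  have hE0 : 0 ≤ E := hE ▸ hR.leakage_nonneg hC α
  -- The comparison solution tends to E/γ, and 1 is the allowance for its transient. Neither α nor E
  -- depends on r, hence neither does b.
  obtain ⟨b, hb, hbS⟩ := Evolution.exists_boundedAt_of_lyapunov_le hR hP α (1 + E / γ)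
  refine ⟨b, hb, fun r => ?_⟩
  obtain ⟨v, hv, hvS⟩ := Evolution.exists_lyapunov_le_of_boundedAt hR P α r
  refine ⟨v / γ, by positivity, fun t₀ T S t₁ ht₀ hS h1 hg hr t ht hT => hbS S t ?_⟩
  have hKP : ∀ v : Fin n → ℝ, ((0 : ℝ) - 1) * (v ⬝ᵥ v) ≤ -γ * quadForm P v := fun v => by
    have h1 := mul_le_mul_of_nonneg_left (hqP v) hγ.le
    have h2 := mul_le_mul_of_nonneg_right hγq (dotProduct_self_nonneg' v)
    linarith
  have hlyap := hS.lyapunov_le hG hPt hARE hR hK hΓ hm hKP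
    (fun i j hi h => neg_le_neg (hγγ.trans (hrate i j hi h))) hL hC
    (fun X Y g t ht hY i hi hg htr => by
      rw [zero_mul, zero_add]
      exact herr X Y g t ht hY i hi hg htr) hα ht₀ h1 hg (hvS S t₁ hr)
    (le_trans (by linarith [div_nonneg hv hγ.le]) ht) hT
  refine hlyap.trans ?_
  rw [← hE, gronwallBound_of_K_ne_0 (neg_ne_zero.mpr hγ.ne')]
  have h2 := mul_exp_neg_le_one hγ (le_sub_iff_add_le'.mpr ht)
  have h3 : E / -γ * (Real.exp (-γ * (t - t₁)) - 1) =
      E / γ - E / γ * Real.exp (-γ * (t - t₁)) := by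
    rw [div_neg]
    ring
  have h4 := mul_nonneg (div_nonneg hE0 hγ.le) (Real.exp_pos (-γ * (t - t₁))).le
  simp only [h3]
  linarith

theorem uniformly_ultimately_bounded (hG : IsLeaderFollowerGraph G ℓ) (hP : P.PosDef)
    (hARE : P * A + Aᵀ * P - P * B * Bᵀ * P + 1 = 0) (hR : R.Admissible G ℓ)
    (hK : R.K = -(Bᵀ * P)) (hΓ : R.Γ = P * B * Bᵀ * P) :
    ∃ b : ℝ, 0 < b ∧ ∀ a : ℝ, 0 < a → ∃ θ : ℝ, 0 ≤ θ ∧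
      ∀ (t₀ : ℝ) (T : EReal) (S : Evolution V n), 0 ≤ t₀ → S.IsClosedLoop G ℓ A B R t₀ T →
        S.BoundedAt G ℓ a t₀ →
          ∀ t : ℝ, t₀ + θ ≤ t → (t : EReal) < T → S.BoundedAt G ℓ b t := by
  have hPt : Pᵀ = P := by simpa using hP.isHermitian.eq
  have hδ := hR.δ_pos
  obtain ⟨b, hb, hbound⟩ := exists_ultimate_bound_of_neg_le hG hP hARE hR hK hΓ
  obtain ⟨γ, hγ, hrate⟩ := hR.exists_rate
  refine ⟨b, hb, fun a ha => ?_⟩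
  -- After this time a·e^{-γθ} ≤ 1/(2δ), so every gain has risen above the threshold of the second
  -- phase.
  obtain ⟨θ₁, hθ₁⟩ : ∃ θ₁, θ₁ = 2 * R.δ * a / γ := ⟨_, rfl⟩
  have hθ₁0 : 0 ≤ θ₁ := by rw [hθ₁]; positivity
  obtain ⟨r, -, hr⟩ := exists_boundedAt_of_horizon hG hP hARE hR hK hΓ a θ₁
  obtain ⟨θ₂, hθ₂, h2⟩ := hbound r
  refine ⟨θ₁ + θ₂, by positivity, fun t₀ T S ht₀ hS hSa t ht hT => ?_⟩
  have hT₁ : ((t₀ + θ₁ : ℝ) : EReal) < T :=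
    (EReal.coe_le_coe_iff.mpr (by linarith)).trans_lt hT
  refine h2 t₀ T S (t₀ + θ₁) ht₀ hS (by linarith) (fun s hs hsT i j hi h => ?_)
    (hr t₀ T S ht₀ hS hSa _ (by linarith) le_rfl hT₁) t (by linarith) hT
  refine le_trans (neg_le_neg ?_) (hS.neg_exp_le_gain hR (R.quadForm_Γ_nonneg hPt hΓ) hi h
    (neg_le_of_abs_le (hSa.2 i j hi h)) (by linarith) hsT)
  have h3 := mul_exp_neg_le_one hγ (v := 2 * R.δ * a) (τ := s - t₀)
    (by rw [← hθ₁]; linarith)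
  have h4 : Real.exp (-(R.κ i j * R.ϱ i j) * (s - t₀)) ≤ Real.exp (-γ * (s - t₀)) :=
    Real.exp_le_exp.mpr (mul_le_mul_of_nonneg_right (by linarith [hrate i j hi h]) (by linarith))
  refine (mul_le_mul_of_nonneg_left h4 ha.le).trans ?_
  rw [le_div_iff₀ (by positivity)]
  linarith

end Boundedness

/-! ### Exclusion of Zeno behavior -/

theorem Evolution.exists_boundedAt {V : Type*} [Fintype V] {n : ℕ} (S : Evolution V n)
    (G : Digraph V) (ℓ : V) (t : ℝ) : ∃ a : ℝ, S.BoundedAt G ℓ a t := by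
  have hx : ∀ i, 0 ≤ S.trackingError ℓ i t := fun i => norm_nonneg _
  refine ⟨∑ i, S.trackingError ℓ i t + ∑ i, ∑ j, |S.c i j t|, fun i _ => ?_, fun i j _ _ => ?_⟩
  · have h1 := Finset.single_le_sum (fun i _ => hx i) (Finset.mem_univ i)
    have h2 : 0 ≤ ∑ i, ∑ j, |S.c i j t| := by positivity
    linarith
  · have h1 := Finset.sum_nonneg fun i (_ : i ∈ Finset.univ) => hx i
    have h2 : |S.c i j t| ≤ ∑ i, ∑ j, |S.c i j t| :=
      (Finset.single_le_sum (f := fun j => |S.c i j t|) (fun _ _ => by positivity)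
        (Finset.mem_univ j)).trans (Finset.single_le_sum (f := fun i => ∑ j, |S.c i j t|)
          (fun _ _ => by positivity) (Finset.mem_univ i))
    linarith

theorem norm_sub_le_trackingError {V : Type*} {n : ℕ} (S : Evolution V n) (ℓ i : V) (t : ℝ) :
    ‖S.x i t - S.x ℓ t‖ ≤ S.trackingError ℓ i t := by
  refine (pi_norm_le_iff_of_nonneg (norm_nonneg _)).mpr fun k => ?_
  exact PiLp.norm_apply_le (WithLp.toLp 2 (S.x i t - S.x ℓ t)) k

theorem dotProduct_self_le_norm_sq {n : ℕ} (v : Fin n → ℝ) : v ⬝ᵥ v ≤ n * ‖v‖ ^ 2 := by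
  rw [sum_sq_eq_dotProduct]
  refine (Finset.sum_le_card_nsmul _ _ (‖v‖ ^ 2) fun i _ => ?_).trans (by simp)
  rw [← sq_abs]
  exact pow_le_pow_left₀ (abs_nonneg _) (norm_le_pi_norm v i) 2

/-- For bounded states, estimates and gains, the measurement error has bounded velocity. -/
theorem Protocol.exists_norm_error_deriv_le {V : Type*} [Fintype V] {n p : ℕ}
    (R : Protocol V n p) (G : Digraph V)
    (A : Matrix (Fin n) (Fin n) ℝ) (B : Matrix (Fin n) (Fin p) ℝ) (i : V) (M : ℝ) :
    ∃ D : ℝ, ∀ (w x : Fin n → ℝ) (y : V → Fin n → ℝ) (g : V → ℝ),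
      ‖w‖ ≤ M → ‖x‖ ≤ M → (∀ j, ‖y j‖ ≤ M) → (∀ j, |g j * adjEntry G i j| ≤ M) →
      ‖A *ᵥ w - (A *ᵥ x + B *ᵥ R.input G i y g)‖ ≤ D := by
  -- The products of gain and adjacency entry form the last variable: gains off the edges need not
  -- be bounded, their products vanish.
  let Φ : (Fin n → ℝ) × (Fin n → ℝ) × (V → Fin n → ℝ) × (V → ℝ) → Fin n → ℝ := fun z =>
    A *ᵥ z.1 - (A *ᵥ z.2.1 + B *ᵥ R.K *ᵥ ∑ j, z.2.2.2 j • (z.2.2.1 i - z.2.2.1 j))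
  have hΦ : Continuous Φ := by
    have hx : Continuous fun z : (Fin n → ℝ) × (Fin n → ℝ) × (V → Fin n → ℝ) × (V → ℝ) =>
        z.2.1 := by
      fun_prop
    have hu : Continuous fun z : (Fin n → ℝ) × (Fin n → ℝ) × (V → Fin n → ℝ) × (V → ℝ) =>
        ∑ j, z.2.2.2 j • (z.2.2.1 i - z.2.2.1 j) := by
      fun_prop
    exact (continuous_const.matrix_mulVec continuous_fst).sub
      ((continuous_const.matrix_mulVec hx).add
        (continuous_const.matrix_mulVec (continuous_const.matrix_mulVec hu)))
  obtain ⟨D, hD⟩ := (isCompact_closedBall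
    (0 : (Fin n → ℝ) × (Fin n → ℝ) × (V → Fin n → ℝ) × (V → ℝ)) M).exists_bound_of_continuousOn
      hΦ.continuousOn
  refine ⟨D, fun w x y g hw hx hy hg => hD (w, x, y, fun j => g j * adjEntry G i j) ?_⟩
  have hM : 0 ≤ M := (norm_nonneg w).trans hw
  rw [mem_closedBall_zero_iff]
  exact max_le hw (max_le hx (max_le ((pi_norm_le_iff_of_nonneg hM).mpr hy)
    ((pi_norm_le_iff_of_nonneg hM).mpr hg)))

section Zeno

variable {V : Type*} [Fintype V] [DecidableEq V] {n p : ℕ} {G : Digraph V} {ℓ : V}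
  {A : Matrix (Fin n) (Fin n) ℝ} {B : Matrix (Fin n) (Fin p) ℝ} {P : Matrix (Fin n) (Fin n) ℝ}
  {R : Protocol V n p}

theorem Protocol.triggerWeight_le (hR : R.Admissible G ℓ) {i : V} {g : V → ℝ} {r : ℝ} (hr : 0 ≤ r)
    (hg : ∀ j, G.Adj j i → g j ≤ r) :
    R.triggerWeight G ℓ i g ≤ Fintype.card V * (1 + R.δ * r) := by
  have hδ := hR.δ_pos
  have hr' : 0 ≤ 1 + R.δ * r := by positivity
  have hterm : ∀ j, (1 + R.δ * g j) * adjEntry G i j ≤ 1 + R.δ * r := fun j => by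
    by_cases h : G.Adj j i
    · rw [adjEntry_of_adj h]
      linarith [mul_le_mul_of_nonneg_left (hg j h) hδ.le]
    · simpa [adjEntry, h] using hr'
  have hcard : ((Finset.univ.erase ℓ).card : ℝ) + 1 = Fintype.card V := by
    exact_mod_cast Finset.card_erase_add_one (Finset.mem_univ ℓ)
  have h1 := Finset.sum_le_card_nsmul (Finset.univ.erase ℓ) _ _ fun j _ => hterm j
  rw [nsmul_eq_mul] at h1
  rw [Protocol.triggerWeight, ← hcard]
  linarith [hterm ℓ]

/-- On a bounded horizon, the states and estimates of all agents are bounded. -/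
theorem Evolution.IsClosedLoop.exists_norm_le {S : Evolution V n} {t₀ : ℝ} {T : EReal}
    (hS : S.IsClosedLoop G ℓ A B R t₀ T) {r s : ℝ}
    (hr : 0 ≤ r) (hb : ∀ t : ℝ, t₀ ≤ t → t ≤ s → (t : EReal) < T → S.BoundedAt G ℓ r t) :
    ∃ M : ℝ, 0 ≤ M ∧ ∀ t : ℝ, t₀ ≤ t → t ≤ s → (t : EReal) < T →
      (∀ i, ‖S.x i t‖ ≤ M) ∧ (∀ i, ‖S.xt i t‖ ≤ M) ∧
      ∀ i t', t ≤ t' → t' ≤ s → ‖predict A t (S.x i t) t'‖ ≤ M := by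
  obtain ⟨Xl, hXl⟩ := exists_norm_predict_le A (s - t₀) ‖S.x ℓ t₀‖
  have hx : ∀ t : ℝ, t₀ ≤ t → t ≤ s → (t : EReal) < T → ∀ i, ‖S.x i t‖ ≤ r + Xl := by
    intro t h0 hts hT i
    have h1 : ‖S.x ℓ t‖ ≤ Xl := by
      rw [← hS.xt_leader_eq h0 hT, hS.xt_leader t h0 hT]
      exact hXl t₀ t h0 (by linarith) _ le_rfl
    rcases eq_or_ne i ℓ with rfl | hi
    · linarith
    · have h2 := (norm_sub_le_trackingError S ℓ i t).trans ((hb t h0 hts hT).1 i hi)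
      have h3 := norm_add_le (S.x i t - S.x ℓ t) (S.x ℓ t)
      rw [sub_add_cancel] at h3
      linarith
  obtain ⟨Y, hY⟩ := exists_norm_predict_le A (s - t₀) (r + Xl)
  refine ⟨max 0 (max (r + Xl) Y), le_max_left _ _, fun t h0 hts hT => ⟨fun i => ?_, fun i => ?_,
    fun i t' h1 h2 => ?_⟩⟩
  · exact (hx t h0 hts hT i).trans ((le_max_left _ _).trans (le_max_right _ _))
  · rcases eq_or_ne i ℓ with rfl | hi
    · rw [hS.xt_leader_eq h0 hT]
      exact (hx t h0 hts hT _).trans ((le_max_left _ _).trans (le_max_right _ _))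
    · obtain ⟨k, hk1, hk2⟩ := hS.τ_cover i hi t h0 hT
      have hk0 : (t₀ : EReal) ≤ S.τ i k := hS.τ_zero i hi ▸ hS.τ_mono i hi (Nat.zero_le k)
      obtain ⟨u, hu⟩ : ∃ u : ℝ, S.τ i k = u :=
        ⟨_, (EReal.coe_toReal (ne_top_of_le_ne_top (EReal.coe_ne_top t) hk1)
          (ne_bot_of_le_ne_bot (EReal.coe_ne_bot t₀) hk0)).symm⟩
      rw [hu, EReal.coe_le_coe_iff] at hk1 hk0
      rw [hS.xt_follower i hi k u t hu hk1 hk2 hT]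
      refine (hY u t hk1 (by linarith) _ (hx u hk0 (hk1.trans hts) ?_ i)).trans
        ((le_max_right _ _).trans (le_max_right _ _))
      exact (EReal.coe_le_coe_iff.mpr hk1).trans_lt hT
  · exact (hY t t' h1 (by linarith) _ (hx t h0 hts hT i)).trans
      ((le_max_right _ _).trans (le_max_right _ _))

/-- On a bounded horizon, consecutive triggering instants of a follower are separated by a positive
distance. -/
theorem Evolution.IsClosedLoop.exists_gap (hG : IsLeaderFollowerGraph G ℓ) (hP : P.PosDef)
    (hARE : P * A + Aᵀ * P - P * B * Bᵀ * P + 1 = 0) (hR : R.Admissible G ℓ)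
    (hK : R.K = -(Bᵀ * P)) (hΓ : R.Γ = P * B * Bᵀ * P) {S : Evolution V n} {t₀ : ℝ} {T : EReal}
    (ht₀ : 0 ≤ t₀) (hS : S.IsClosedLoop G ℓ A B R t₀ T) {i : V} (hi : i ≠ ℓ) (s : ℝ) :
    ∃ d : ℝ, 0 < d ∧ ∀ (k : ℕ) (u u' : ℝ), S.τ i k = u → S.τ i (k + 1) = u' →
      (u' : EReal) < T → u' ≤ s → u + d ≤ u' := by
  have hPt : Pᵀ = P := by simpa using hP.isHermitian.eq
  have hq := R.quadForm_Γ_nonneg hPt hΓ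
  have hδ := hR.δ_pos
  have hμ := hR.μ_pos
  obtain ⟨a, ha⟩ := S.exists_boundedAt G ℓ t₀
  obtain ⟨r, hr, hrS⟩ := exists_boundedAt_of_horizon hG hP hARE hR hK hΓ a (s - t₀)
  have hb : ∀ t : ℝ, t₀ ≤ t → t ≤ s → (t : EReal) < T → S.BoundedAt G ℓ r t :=
    fun t h0 hts hT => hrS t₀ T S ht₀ hS ha t h0 (by linarith) hT
  obtain ⟨M, hM, hMS⟩ := hS.exists_norm_le hr.le hb
  obtain ⟨D, hD⟩ := R.exists_norm_error_deriv_le G A B i (max M r)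
  obtain ⟨CΓ, hCΓ, hquad⟩ := exists_quadForm_le R.Γ
  obtain ⟨Z, hZ⟩ : ∃ Z, Z = Fintype.card V * (1 + R.δ * r) * (CΓ * n) := ⟨_, rfl⟩
  have hZ0 : 0 ≤ Z := by rw [hZ]; positivity
  have hc : 0 < R.μ * Real.exp (-R.ν * s) := by positivity
  have hZD : 0 < Z * D ^ 2 + 1 := by positivity
  -- The trigger forces μ e^{-νs} ≤ Z D² (u' - u)²; the added 1 excludes division by zero.
  refine ⟨√(R.μ * Real.exp (-R.ν * s) / (Z * D ^ 2 + 1)), Real.sqrt_pos.mpr (by positivity),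
    fun k u u' hu hu' hT hs => ?_⟩
  have hu0 : t₀ ≤ u := by
    have h := hS.τ_mono i hi (Nat.zero_le k)
    rwa [hS.τ_zero i hi, hu, EReal.coe_le_coe_iff] at h
  have huu' : u ≤ u' := by
    have h := hS.τ_mono i hi (Nat.le_succ k)
    rwa [hu, Nat.succ_eq_add_one, hu', EReal.coe_le_coe_iff] at h
  have hsub := Icc_subset_horizon hu0 hT
  have huT : (u : EReal) < T := (hsub ⟨le_rfl, huu'⟩).2
  have hcont : ContinuousOn (fun t => predict A u (S.x i u) t - S.x i t) (Set.Icc u u') :=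
    ContinuousOn.sub (fun t _ =>
      (hasDerivAt_predict A u (S.x i u) t).continuousAt.continuousWithinAt)
      ((hS.x_cont i).mono hsub)
  have herror := norm_image_sub_le_of_norm_deriv_right_le_segment hcont
    (f' := fun t => A *ᵥ predict A u (S.x i u) t -
      (A *ᵥ S.x i t + B *ᵥ R.input G i (fun j => S.xt j t) (fun j => S.c i j t)))
    (fun t ht => (hasDerivAt_predict A u (S.x i u) t).hasDerivWithinAt.sub
      (hS.follower i hi t (hsub ⟨ht.1, ht.2.le⟩).1 (hsub ⟨ht.1, ht.2.le⟩).2))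
    (C := D) (fun t ht => by
      obtain ⟨h0, htT⟩ := hsub ⟨ht.1, ht.2.le⟩
      have hts : t ≤ s := ht.2.le.trans hs
      obtain ⟨hx, hxt, -⟩ := hMS t h0 hts htT
      refine hD _ _ _ _ (((hMS u hu0 (huu'.trans hs) huT).2.2 i t ht.1 hts).trans (le_max_left _ _))
        ((hx i).trans (le_max_left _ _)) (fun j => (hxt j).trans (le_max_left _ _)) fun j => ?_
      by_cases h : G.Adj j i
      · rw [adjEntry_of_adj h, mul_one]
        exact ((hb t h0 hts htT).2 i j hi h).trans (le_max_right _ _)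
      · simpa [adjEntry, h] using Or.inr hr.le) u' ⟨huu', le_rfl⟩
  simp only [predict_self, sub_self, sub_zero] at herror
  obtain ⟨y, -, hy⟩ := hS.fires i hi k u u' hu hu' hT
  -- The terms containing y can only lower the triggering function, so both conventions for
  -- simultaneous events give the same bound.
  rw [Protocol.trigger_eq] at hy
  set e := predict A u (S.x i u) u' - S.x i u' with he
  have hweight : R.triggerWeight G ℓ i (fun j => S.c i j u') ≤
      Fintype.card V * (1 + R.δ * r) :=
    R.triggerWeight_le hR hr.le fun j h =>
      (le_abs_self _).trans ((hb u' (hu0.trans huu') hs hT).2 i j hi h)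
  have h1 := mul_le_mul_of_nonneg_right hweight (hq e)
  have h2 : quadForm R.Γ e ≤ CΓ * (n * (D * (u' - u)) ^ 2) := by
    refine (hquad e).trans (mul_le_mul_of_nonneg_left ?_ hCΓ.le)
    refine (dotProduct_self_le_norm_sq e).trans ?_
    exact mul_le_mul_of_nonneg_left (pow_le_pow_left₀ (norm_nonneg _) herror 2) n.cast_nonneg
  have h3 := mul_le_mul_of_nonneg_left h2
    (by positivity : 0 ≤ Fintype.card V * (1 + R.δ * r))
  have h4 : 0 ≤ ∑ j, adjEntry G i j * quadForm R.Γ (predict A u (S.x i u) u' - y j) :=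
    Finset.sum_nonneg fun j _ => mul_nonneg (adjEntry_nonneg _ _ _) (hq _)
  have h5 := mul_nonneg (adjEntry_nonneg G i ℓ) (hq (predict A u (S.x i u) u' - y ℓ))
  have h6 : R.μ * Real.exp (-R.ν * s) ≤ R.μ * Real.exp (-R.ν * u') :=
    mul_le_mul_of_nonneg_left (Real.exp_le_exp.mpr (by
      nlinarith [mul_le_mul_of_nonneg_left hs hR.ν_pos.le])) hμ.le
  have h7 : R.μ * Real.exp (-R.ν * s) ≤ Z * (D * (u' - u)) ^ 2 := by
    have e1 : Z * (D * (u' - u)) ^ 2 =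
        Fintype.card V * (1 + R.δ * r) * (CΓ * (n * (D * (u' - u)) ^ 2)) := by rw [hZ]; ring
    rw [e1]
    linarith
  have h8 : √(R.μ * Real.exp (-R.ν * s) / (Z * D ^ 2 + 1)) ≤ u' - u := by
    rw [Real.sqrt_le_left (sub_nonneg.mpr huu'), div_le_iff₀ hZD]
    nlinarith [sq_nonneg (u' - u)]
  linarith

theorem Evolution.IsClosedLoop.finite_triggers (hG : IsLeaderFollowerGraph G ℓ) (hP : P.PosDef)
    (hARE : P * A + Aᵀ * P - P * B * Bᵀ * P + 1 = 0) (hR : R.Admissible G ℓ)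
    (hK : R.K = -(Bᵀ * P)) (hΓ : R.Γ = P * B * Bᵀ * P) {S : Evolution V n} {t₀ : ℝ} {T : EReal}
    (ht₀ : 0 ≤ t₀) (hS : S.IsClosedLoop G ℓ A B R t₀ T) {i : V} (hi : i ≠ ℓ) (s : ℝ) :
    {k : ℕ | S.τ i k < T ∧ S.τ i k ≤ s}.Finite := by
  by_contra hinf
  -- Monotonicity extends the bound from infinitely many indices to all; a uniform gap then pushes
  -- the instants past s, even if they were to accumulate at T.
  have hall : ∀ k, S.τ i k < T ∧ S.τ i k ≤ s := fun k => by
    obtain ⟨k', hk', hkk'⟩ := Set.Infinite.exists_gt hinf k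
    have hle := hS.τ_mono i hi hkk'.le
    exact ⟨hle.trans_lt hk'.1, hle.trans hk'.2⟩
  have hreal : ∀ k, ∃ u : ℝ, S.τ i k = u := fun k => by
    have hk0 : (t₀ : EReal) ≤ S.τ i k := hS.τ_zero i hi ▸ hS.τ_mono i hi (Nat.zero_le k)
    exact ⟨_, (EReal.coe_toReal (ne_top_of_le_ne_top (EReal.coe_ne_top s) (hall k).2)
      (ne_bot_of_le_ne_bot (EReal.coe_ne_bot t₀) hk0)).symm⟩
  choose u hu using hreal
  have hus : ∀ k, u k ≤ s := fun k => by
    have h := (hall k).2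
    rwa [hu, EReal.coe_le_coe_iff] at h
  obtain ⟨d, hd, hgap⟩ := Evolution.IsClosedLoop.exists_gap hG hP hARE hR hK hΓ ht₀ hS hi s
  have hgrow : ∀ k : ℕ, u 0 + k * d ≤ u k := by
    intro k
    induction k with
    | zero => simp
    | succ k ih =>
      have h := hgap k (u k) (u (k + 1)) (hu k) (hu (k + 1)) (hu (k + 1) ▸ (hall (k + 1)).1)
        (hus (k + 1))
      push_cast
      linarith
  obtain ⟨k, hk⟩ := exists_nat_gt ((s - u 0) / d)
  rw [div_lt_iff₀ hd] at hk
  linarith [hgrow k, hus k]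

end Zeno

theorem theorem4 {V : Type*} [Fintype V] [DecidableEq V] {n p : ℕ}
    (G : Digraph V) (ℓ : V) (hG : IsLeaderFollowerGraph G ℓ)
    (A : Matrix (Fin n) (Fin n) ℝ) (B : Matrix (Fin n) (Fin p) ℝ) (hAB : Stabilizable A B)
    (P : Matrix (Fin n) (Fin n) ℝ) (hP : P.PosDef)
    (hARE : P * A + Aᵀ * P - P * B * Bᵀ * P + 1 = 0)
    (R : Protocol V n p) (hR : R.Admissible G ℓ)
    (hK : R.K = -(Bᵀ * P)) (hΓ : R.Γ = P * B * Bᵀ * P) :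
    (∃ b : ℝ, 0 < b ∧ ∀ a : ℝ, 0 < a → ∃ θ : ℝ, 0 ≤ θ ∧
      ∀ (t₀ : ℝ) (T : EReal) (S : Evolution V n), 0 ≤ t₀ → S.IsClosedLoop G ℓ A B R t₀ T →
        S.BoundedAt G ℓ a t₀ →
          ∀ t : ℝ, t₀ + θ ≤ t → (t : EReal) < T → S.BoundedAt G ℓ b t) ∧
    (∀ (t₀ : ℝ) (T : EReal) (S : Evolution V n), 0 ≤ t₀ → S.IsClosedLoop G ℓ A B R t₀ T →
      ∀ i, i ≠ ℓ → ∀ s : ℝ, {k : ℕ | S.τ i k < T ∧ S.τ i k ≤ s}.Finite) :=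
  ⟨uniformly_ultimately_bounded hG hP hARE hR hK hΓ, fun _ _ _ ht₀ hS _ hi s =>
    Evolution.IsClosedLoop.finite_triggers hG hP hARE hR hK hΓ ht₀ hS hi s⟩
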